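/- Let $\underline{C}$ be a triangulated category (with Hom-sets) having all small coproducts. "Classes" are classes of objects of $\underline{C}$, and "small" means set-indexed. We use the following terminology. * $X\perp Y$ means $\underline{C}(X,Y)=0$; $D^\perp=\{Y: X\perp Y\ \forall X\in D\}$ and ${}^\perp D=\{Y: Y\perp X\ \forall X\in D\}$. An object $M$ is *compact* if $\underline{C}(M,-):\underline{C}\to \mathrm{Ab}$ respects small coproducts. A class is *smashing* if it is closed under small coproducts. * A class is *extension-closed* if it contains $0$ and contains $Y$ whenever there is a distinguished triangle $X\to Y\to Z\to X[1]$ with $X,Z$ in the class. The *envelope* of $\mathcal{P}$ is the smallest retraction-closed extension-closed class containing $\mathcal{P}$. * The *homotopy colimit* of a sequence $Y_0\xrightarrow{f_0}Y_1\xrightarrow{f_1}\cdots$ is any cone of the endomorphism of $\coprod_i Y_i$ whose restriction to $Y_i$ has components $\mathrm{id}_{Y_i}$ and $-f_i$. A class is *strongly extension-closed* if it contains $0$ and contains every homotopy colimit of every sequence such that $Y_0$ and all cones of the $f_i$ lie in the class. The *strong extension-closure* of $\mathcal{P}$ is the smallest strongly extension-closed, retraction-closed, smashing class containing $\mathcal{P}$.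 The *naive big hull* of $\mathcal{P}$ is the class of homotopy colimits of those sequences for which $Y_0$ and the cones of all $f_i$ are small coproducts of objects of $\mathcal{P}$; the *big hull* of $\mathcal{P}$ is the class of retracts of objects of the naive big hull. * A *torsion theory* is a couple $s=(\mathcal{LO},\mathcal{RO})$ of classes with $\mathcal{LO}^\perp=\mathcal{RO}$, $\mathcal{LO}={}^\perp\mathcal{RO}$, such that for every object $M$ there is a distinguished triangle $L_sM\to M\to R_sM\to L_sM[1]$ with $L_sM\in\mathcal{LO}$, $R_sM\in\mathcal{RO}$ (any such triangle is an $s$-decomposition of $M$). It is *smashing* if $\mathcal{RO}$ is smashing; it is *generated by* $\mathcal{P}$ if $\mathcal{P}^\perp=\mathcal{RO}$, and *compactly generated* if it is generated by some set of compact objects. It is *associated to a $t$-structure* $t$ if $\mathcal{LO}=\underline{C}_{t\ge 0}$ and $\mathcal{RO}[1]=\underline{C}_{t\le 0}$ (homological convention). * A *cc functor* is a homological functor $\underline{C}\to\underline{A}$ to an abelian category that respects small coproducts; a *cp functor* is a cohomological functor $\underline{C}^{op}\to\underline{A}$ that converts small coproducts into products. **Theorem.** Let $\mathcal{P}$ be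 a set of compact objects of $\underline{C}$. 1. The strong extension-closure $\mathcal{LO}$ of $\mathcal{P}$ and $\mathcal{RO}=\mathcal{P}^\perp$ form a smashing torsion theory $s$; it is the (unique) torsion theory generated by $\mathcal{P}$. Moreover, $\mathcal{LO}$ equals the big hull of $\mathcal{P}$, and every object $M$ has an $s$-decomposition such that $L_sM$ belongs to the naive big hull of $\mathcal{P}$. 2. The class of compact objects in $\mathcal{LO}$ equals the envelope of $\mathcal{P}$. 3. Sending a compactly generated torsion theory $(\mathcal{LO},\mathcal{RO})$ to the class of compact objects in $\mathcal{LO}$ is a bijection from the compactly generated torsion theories on $\underline{C}$ onto the essentially small retraction-closed extension-closed classes of compact objects of $\underline{C}$. 4. If the torsion theory $s$ generated by $\mathcal{P}$ is associated to a $t$-structure $t$, then $\mathcal{LO}=\underline{C}_{t\ge 0}$ equals the naive big hull of $\mathcal{P}$. 5. Let $H$ be either a cc functor from $\underline{C}$ to an AB5 category $\underline{A}$, or a cp functor from $\underline{C}$ to an AB4\* category $\underline{A}$ with the following property: for every sequence of epimorphisms $\cdots\to E_2\to E_1\to E_0$ in $\underline{A}$ the projections $\varprojlim E_i\to E_n$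 are epimorphisms (this holds for instance if $\underline{A}$ has enough projectives, in particular for abelian groups). If $H$ vanishes on $\mathcal{P}$, then $H$ vanishes on $\mathcal{LO}$. -/

import Mathlib

open CategoryTheory CategoryTheory.Limits CategoryTheory.Pretriangulated
open CategoryTheory.Triangulated

universe v u v' u'

namespace TorsionHull

section Basic

variable {C : Type u} [Category.{v} C]

/-- A class of objects is smashing if it is closed under small coproducts. -/
def IsSmashingClass (P : ObjectProperty C) : Prop :=
  ∀ J : Type v, P.IsClosedUnderColimitsOfShape (Discrete J)

/-- The closure of a class of objects under small coproducts: the smallest isomorphism-closed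
class which contains `P` and is closed under small coproducts. The empty coproduct is allowed,
so zero objects belong to it. -/
def coproductClosure (P : ObjectProperty C) : ObjectProperty C :=
  P.colimitsClosure (fun J : Type v ↦ Discrete J)

/-- A functor respects small coproducts. -/
def RespectsCoproducts {A : Type u'} [Category.{v'} A] (H : C ⥤ A) : Prop :=
  ∀ J : Type v, PreservesColimitsOfShape (Discrete J) H

/-- A contravariant functor converts small coproducts into products. Products indexed by `J`
in `Cᵒᵖ` are the coproducts indexed by `J` in `C`. -/
def CoproductsToProducts {A : Type u'} [Category.{v'} A] (H : Cᵒᵖ ⥤ A) : Prop :=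
  ∀ J : Type v, PreservesLimitsOfShape (Discrete J) H

/-- Inverse limits of sequences of epimorphisms in `A` project epimorphically onto their terms:
if all the transition morphisms of `⋯ ⟶ F 2 ⟶ F 1 ⟶ F 0` are epimorphisms, then so are the
projections from the limit. This holds, for instance, in the category of abelian groups. -/
def SequentialLimitsOfEpis (A : Type u') [Category.{v'} A] : Prop :=
  ∀ (F : ℕᵒᵖ ⥤ A) (c : Cone F), IsLimit c →
    (∀ n : ℕ, Epi (F.map (homOfLE (Nat.le_succ n)).op)) →
      ∀ n : ℕ, Epi (c.π.app (Opposite.op n))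

/-- The class of compact objects: the objects `M` such that the functor `C(M, -)` with values in
abelian groups respects small coproducts. -/
def compactObjects (C : Type u) [Category.{v} C] [Preadditive C] : ObjectProperty C :=
  fun M ↦ RespectsCoproducts (preadditiveCoyoneda.obj (Opposite.op M))

end Basic

section Triangulated

variable {C : Type u} [Category.{v} C] [HasZeroObject C] [HasShift C ℤ] [Preadditive C]
  [∀ n : ℤ, (shiftFunctor C n).Additive] [Pretriangulated C]

/-- A class of objects is extension-closed if it contains zero and, for every distinguished
triangle `X ⟶ Y ⟶ Z ⟶ X⟦1⟧` with `X` and `Z` in the class, also contains `Y`. -/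
structure IsExtensionClosed (P : ObjectProperty C) : Prop where
  containsZero : P.ContainsZero
  ext : ∀ T : Triangle C, T ∈ distTriang C → P T.obj₁ → P T.obj₃ → P T.obj₂

/-- The envelope of `P`: the smallest retraction-closed extension-closed class containing `P`. -/
def envelope (P : ObjectProperty C) : ObjectProperty C :=
  sInf {Q | Q.IsStableUnderRetracts ∧ IsExtensionClosed Q ∧ P ≤ Q}

/-- `Z` is a cone of `f`. -/
def IsCone {X Y : C} (f : X ⟶ Y) (Z : C) : Prop :=
  ∃ (g : Y ⟶ Z) (h : Z ⟶ X⟦(1 : ℤ)⟧), Triangle.mk f g h ∈ distTriang C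

/-- A homological functor that respects all small coproducts. -/
structure IsCCFunctor {A : Type u'} [Category.{v'} A] [Abelian A] (H : C ⥤ A) : Prop where
  additive : H.Additive
  homological : H.IsHomological
  coproducts : RespectsCoproducts H

/-- A cohomological functor (an additive contravariant functor that, regarded as a functor from
`C` to the opposite of `A`, is homological) that converts small coproducts into products. -/
structure IsCPFunctor {A : Type u'} [Category.{v'} A] [Abelian A] (H : Cᵒᵖ ⥤ A) : Prop where
  additive : H.Additive
  cohomological : H.rightOp.IsHomological
  products : CoproductsToProducts H

variable (C) in
/-- A torsion theory: a couple `(left, right)` of classes of objects such that each of them is the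
orthogonal of the other, and every object `M` has a decomposition triangle
`L ⟶ M ⟶ R ⟶ L⟦1⟧` with `L` in `left` and `R` in `right`. -/
@[ext]
structure TorsionTheory where
  left : ObjectProperty C
  right : ObjectProperty C
  rightOrthogonal_left : left.rightOrthogonal = right
  leftOrthogonal_right : right.leftOrthogonal = left
  exists_triangle : ∀ M : C, ∃ (L R : C) (a : L ⟶ M) (n : M ⟶ R) (d : R ⟶ L⟦(1 : ℤ)⟧),
    Triangle.mk a n d ∈ distTriang C ∧ left L ∧ right R

namespace TorsionTheory

variable (s : TorsionTheory C)

/-- `L` is a choice of the left term in a decomposition triangle of `M`. -/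
def IsLeftPart (L M : C) : Prop :=
  ∃ (R : C) (a : L ⟶ M) (n : M ⟶ R) (d : R ⟶ L⟦(1 : ℤ)⟧),
    Triangle.mk a n d ∈ distTriang C ∧ s.left L ∧ s.right R

/-- The torsion theory is generated by `P` if its right class is the orthogonal of `P`. -/
def IsGeneratedBy (P : ObjectProperty C) : Prop :=
  P.rightOrthogonal = s.right

/-- The torsion theory is smashing if its right class is closed under small coproducts (this is
only used when `C` has small coproducts). -/
def IsSmashing : Prop :=
  IsSmashingClass s.right

/-- The torsion theory is compactly generated if it is generated by a (small) set of compact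
objects. -/
def IsCompactlyGenerated : Prop :=
  ∃ P : ObjectProperty C, ObjectProperty.Small.{v} P ∧ P ≤ compactObjects C ∧ s.IsGeneratedBy P

/-- The torsion theory is associated with the t-structure `t`. In homological notation
this means `C_{t ≥ 0} = left` and `C_{t ≤ 0} = right[1]`; these two classes are `t.le 0` and
`t.ge 0` in the cohomological indexing of Mathlib, and `X` belongs to `right[1]` if and only
if `X⟦-1⟧` belongs to `right`. -/
def IsAssociatedWith (t : TStructure C) : Prop :=
  t.le 0 = s.left ∧ t.ge 0 = s.right.shift (-1 : ℤ)

/-- The class of compact objects in the left class. -/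
def compactPart : ObjectProperty C :=
  s.left ⊓ compactObjects C

end TorsionTheory

end Triangulated

section HomotopyColimits

variable {C : Type u} [Category.{v} C] [HasZeroObject C] [HasShift C ℤ] [Preadditive C]
  [∀ n : ℤ, (shiftFunctor C n).Additive] [Pretriangulated C] [HasCoproducts.{v} C]

/-- The endomorphism of `∐ Y` whose restriction to `Y i` is `Y i ⟶ Y i ⨿ Y (i + 1) ⟶ ∐ Y`, with
components the identity and `-f i`. -/
noncomputable def telescopeMap (Y : ℕ → C) (f : ∀ i, Y i ⟶ Y (i + 1)) : ∐ Y ⟶ ∐ Y :=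
  Sigma.desc (fun i ↦ Sigma.ι Y i - f i ≫ Sigma.ι Y (i + 1))

/-- `X` is a homotopy colimit of the sequence `Y 0 ⟶ Y 1 ⟶ Y 2 ⟶ ⋯`. -/
def IsHomotopyColimit (Y : ℕ → C) (f : ∀ i, Y i ⟶ Y (i + 1)) (X : C) : Prop :=
  IsCone (telescopeMap Y f) X

/-- The class of all homotopy colimits of sequences `Y 0 ⟶ Y 1 ⟶ Y 2 ⟶ ⋯` such that
`Y 0` and the cones of all connecting morphisms belong to `P`. -/
def sequentialExtensions (P : ObjectProperty C) : ObjectProperty C :=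
  fun X ↦ ∃ (Y : ℕ → C) (f : ∀ i, Y i ⟶ Y (i + 1)),
    P (Y 0) ∧ (∀ i, ∃ Z, P Z ∧ IsCone (f i) Z) ∧ IsHomotopyColimit Y f X

/-- A class of objects is strongly extension-closed if it contains zero and all
homotopy colimits of sequences whose initial term and cones belong to it. -/
structure IsStronglyExtensionClosed (P : ObjectProperty C) : Prop where
  containsZero : P.ContainsZero
  sequentialExtensions_le : sequentialExtensions P ≤ P

/-- The strong extension-closure of `P`: the smallest strongly extension-closed retraction-closed
class that contains `P` and is closed under small coproducts. -/
def strongExtensionClosure (P : ObjectProperty C) : ObjectProperty C :=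
  sInf {Q | IsStronglyExtensionClosed Q ∧ Q.IsStableUnderRetracts ∧ IsSmashingClass Q ∧ P ≤ Q}

/-- The naive big hull of `P`: all homotopy colimits of sequences whose initial term and cones are
coproducts of objects of `P`. -/
def naiveBigHull (P : ObjectProperty C) : ObjectProperty C :=
  sequentialExtensions (coproductClosure P)

/-- The big hull of `P`: all retracts of objects of the naive big hull. -/
def bigHull (P : ObjectProperty C) : ObjectProperty C :=
  (naiveBigHull P).retractClosure

end HomotopyColimits

end TorsionHull

/-! The core is a countable small object argument. Let `Y 0` be the coproduct of the sources of all
morphisms from `P` to `M`. Given `Y n ⟶ M`, attach cells so that morphisms from `P` to `(Y n)⟦1⟧`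
which die in `M⟦1⟧` already die in `(Y (n + 1))⟦1⟧`. The homotopy colimit `L` lies in the naive big
hull. Compact objects map to it through finite stages, so the cone `R` of `L ⟶ M` is right
orthogonal to `P` (`exists_decomposition`). If `M` is left orthogonal to `R`, then `M ⟶ R` vanishes
and `M` is a retract of `L`. Since left orthogonals are strongly extension-closed, the big hull, the
strong extension-closure and the double orthogonal of `P` coincide. For a t-structure, `R` is
moreover a retract of `L⟦1⟧`, to which it is orthogonal; hence `R` is zero and `M` is isomorphic to
`L`.

The other statements use the minimality of the strong extension-closure: it suffices to find a
larger class with the same closure properties. For compact objects this is the class of `X` such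
that morphisms from compact objects to `X` factor through the envelope
(`compactlyApproximated_stronglyExtensionClosed`); the identity of a compact `M` in it exhibits `M`
as a retract of an object of the envelope. For a functor `H` it is the class of objects killed by
`H`, where the conditions on the target category make telescopes of monomorphisms monic
(`annihilated_stronglyExtensionClosed`). The bijection follows because a compactly generated torsion
theory is generated by its compact part, and the envelope of a set is essentially small. -/

namespace TorsionHull

universe w

/-! ### Coproducts and finite sums of morphisms into them -/

section Coproducts

variable {C : Type u} [Category.{v} C] {J : Type w} {Y : J → C} {S : C} {ι : ∀ j, Y j ⟶ S}

/-- A morphism out of a coproduct given by a family of morphisms. -/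
def coprodDesc (hS : IsColimit (Cofan.mk S ι)) {Z : C} (k : ∀ j, Y j ⟶ Z) : S ⟶ Z :=
  Cofan.IsColimit.desc hS k

@[simp]
lemma ι_coprodDesc (hS : IsColimit (Cofan.mk S ι)) {Z : C} (k : ∀ j, Y j ⟶ Z) (j : J) :
    ι j ≫ coprodDesc hS k = k j :=
  Cofan.IsColimit.fac hS k j

lemma coprod_hom_ext (hS : IsColimit (Cofan.mk S ι)) {Z : C} {a b : S ⟶ Z}
    (h : ∀ j, ι j ≫ a = ι j ≫ b) : a = b :=
  Cofan.IsColimit.hom_ext hS a b h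

/-- A cofan is a colimit if morphisms out of it are uniquely determined by arbitrary families. -/
noncomputable def isColimitCofan
    (h : ∀ (Z : C) (k : ∀ j, Y j ⟶ Z), ∃! a : S ⟶ Z, ∀ j, ι j ≫ a = k j) :
    IsColimit (Cofan.mk S ι) :=
  Cofan.IsColimit.mk _ (fun t ↦ (h t.pt t.inj).choose)
    (fun t j ↦ (h t.pt t.inj).choose_spec.1 j)
    (fun t m hm ↦ (h t.pt t.inj).choose_spec.2 m hm)

/-- The coproduct cofan underlying a colimit cocone on a discrete category. -/
noncomputable def isColimitCofanOfDiscrete {F : Discrete J ⥤ C} {c : Cocone F} (hc : IsColimit c) :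
    IsColimit (Cofan.mk c.pt (fun j ↦ c.ι.app ⟨j⟩) : Cofan (fun j ↦ F.obj ⟨j⟩)) :=
  isColimitCofan (fun Z k ↦ by
    let s : Cocone F := ⟨Z, Discrete.natTrans (fun j ↦ k j.as)⟩
    exact ⟨hc.desc s, fun j ↦ hc.fac s ⟨j⟩,
      fun a ha ↦ hc.hom_ext (fun j ↦ (ha j.as).trans (hc.fac s j).symm)⟩)

lemma isSmashingClass_iff {P : ObjectProperty C} :
    IsSmashingClass P ↔ ∀ (J : Type v) (Y : J → C) (S : C) (ι : ∀ j, Y j ⟶ S),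
      IsColimit (Cofan.mk S ι) → (∀ j, P (Y j)) → P S := by
  refine ⟨fun h J Y S ι hS hY ↦ ?_, fun h J ↦ ⟨?_⟩⟩
  · have := h J
    exact P.prop_of_isColimit hS (fun j ↦ hY j.as)
  · rintro X ⟨hX⟩
    exact h J _ _ _ (isColimitCofanOfDiscrete hX.isColimit) (fun j ↦ hX.prop_diag_obj ⟨j⟩)

lemma coproductClosure_le {P Q : ObjectProperty C} [Q.IsClosedUnderIsomorphisms]
    (hQ : IsSmashingClass Q) (h : P ≤ Q) : coproductClosure P ≤ Q := by
  have : ∀ J : Type v, Q.IsClosedUnderColimitsOfShape (Discrete J) := hQ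
  exact ObjectProperty.colimitsClosure_le h

variable {A : Type u'} [Category.{v'} A]

lemma RespectsCoproducts.preservesColimitsOfShape {H : C ⥤ A} (hH : RespectsCoproducts H)
    (J : Type w) [Small.{v} J] : PreservesColimitsOfShape (Discrete J) H := by
  have := hH (Shrink.{v} J)
  exact preservesColimitsOfShape_of_equiv (Discrete.equivalence (equivShrink.{v} J).symm) H

lemma CoproductsToProducts.rightOp {H : Cᵒᵖ ⥤ A} (hH : CoproductsToProducts H) :
    RespectsCoproducts H.rightOp := by
  intro J
  have := hH J
  have : PreservesLimitsOfShape (Discrete J)ᵒᵖ H :=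
    preservesLimitsOfShape_of_equiv (Discrete.opposite J).symm H
  exact preservesColimitsOfShape_rightOp (Discrete J) H

section Preadditive

variable [Preadditive C]

open Classical in
/-- The projection of a coproduct onto one of its summands. -/
noncomputable def coprodProj (hS : IsColimit (Cofan.mk S ι)) (i : J) : S ⟶ Y i :=
  coprodDesc hS (fun j ↦ if h : j = i then eqToHom (by rw [h]) else 0)

@[simp]
lemma ι_coprodProj_self (hS : IsColimit (Cofan.mk S ι)) (i : J) :
    ι i ≫ coprodProj hS i = 𝟙 _ := by
  simp [coprodProj]

lemma ι_coprodProj_of_ne (hS : IsColimit (Cofan.mk S ι)) {i j : J} (h : i ≠ j) :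
    ι i ≫ coprodProj hS j = 0 := by
  simp [coprodProj, h]

/-- The morphisms to a coproduct which are finite sums of morphisms to the summands. -/
def finitaryHoms (ι : ∀ j, Y j ⟶ S) (K : C) : AddSubgroup (K ⟶ S) :=
  AddSubgroup.closure {x | ∃ (j : J) (y : K ⟶ Y j), x = y ≫ ι j}

lemma comp_ι_mem_finitaryHoms {K : C} (j : J) (y : K ⟶ Y j) : y ≫ ι j ∈ finitaryHoms ι K :=
  AddSubgroup.subset_closure ⟨j, y, rfl⟩

lemma finitaryHoms_precomp {K K' : C} (a : K' ⟶ K) {x : K ⟶ S} (hx : x ∈ finitaryHoms ι K) :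
    a ≫ x ∈ finitaryHoms ι K' := by
  induction hx using AddSubgroup.closure_induction with
  | mem x hx =>
    obtain ⟨j, y, rfl⟩ := hx
    rw [← Category.assoc]
    exact comp_ι_mem_finitaryHoms j _
  | zero => simp
  | add x y _ _ hx hy => simpa using AddSubgroup.add_mem _ hx hy
  | neg x _ hx => simpa using AddSubgroup.neg_mem _ hx

/-- Allowing every larger `t` lets the supports of two summands be replaced by their union. -/
lemma exists_eq_sum_of_mem_finitaryHoms (hS : IsColimit (Cofan.mk S ι)) {K : C} {x : K ⟶ S}
    (hx : x ∈ finitaryHoms ι K) :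
    ∃ s : Finset J, ∀ t, s ⊆ t → x = ∑ j ∈ t, (x ≫ coprodProj hS j) ≫ ι j := by
  classical
  induction hx using AddSubgroup.closure_induction with
  | mem x hx =>
    obtain ⟨j, y, rfl⟩ := hx
    refine ⟨{j}, fun t ht ↦ ?_⟩
    rw [Finset.sum_eq_single j]
    · simp
    · intro i _ hi
      simp [ι_coprodProj_of_ne hS hi.symm]
    · intro h
      exact (h (ht (by simp))).elim
  | zero => exact ⟨∅, fun t _ ↦ by simp⟩
  | add x y _ _ hx hy =>
    obtain ⟨s, hs⟩ := hx
    obtain ⟨s', hs'⟩ := hy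
    refine ⟨s ∪ s', fun t ht ↦ ?_⟩
    simp only [Preadditive.add_comp, Finset.sum_add_distrib]
    rw [← hs t (Finset.union_subset_left ht), ← hs' t (Finset.union_subset_right ht)]
  | neg x _ hx =>
    obtain ⟨s, hs⟩ := hx
    refine ⟨s, fun t ht ↦ ?_⟩
    simp only [Preadditive.neg_comp, Finset.sum_neg_distrib]
    rw [← hs t ht]

lemma mem_finitaryHoms_of_finite [Finite J] (hS : IsColimit (Cofan.mk S ι)) {K : C} (x : K ⟶ S) :
    x ∈ finitaryHoms ι K := by
  classical
  have := Fintype.ofFinite J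
  have h : 𝟙 S = ∑ j, coprodProj hS j ≫ ι j := coprod_hom_ext hS (fun j ↦ by
    rw [Preadditive.comp_sum, Finset.sum_eq_single j]
    · rw [← Category.assoc, ι_coprodProj_self, Category.comp_id, Category.id_comp]
    · intro i _ hi
      rw [← Category.assoc, ι_coprodProj_of_ne hS hi.symm, Limits.zero_comp]
    · simp)
  rw [← Category.comp_id x, h, Preadditive.comp_sum]
  refine AddSubgroup.sum_mem _ (fun j _ ↦ ?_)
  rw [← Category.assoc]
  exact comp_ι_mem_finitaryHoms j _

lemma eq_zero_of_mem_finitaryHoms (hS : IsColimit (Cofan.mk S ι)) {K : C} {x : K ⟶ S}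
    (hx : x ∈ finitaryHoms ι K) (h : ∀ j, x ≫ coprodProj hS j = 0) : x = 0 := by
  obtain ⟨s, hs⟩ := exists_eq_sum_of_mem_finitaryHoms hS hx
  rw [hs s subset_rfl]
  simp [h]

end Preadditive

end Coproducts

/-! ### Compact objects -/

section Compact

variable {C : Type u} [Category.{v} C] [Preadditive C]

/-- The quotient of `K ⟶ S` by the finitary morphisms receives the zero map from each summand, so
the universal property of the coproduct of Hom groups makes the quotient map zero. -/
lemma mem_finitaryHoms_of_compact {K : C} (hK : compactObjects C K) {J : Type w} [Small.{v} J]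
    {Y : J → C} {S : C} {ι : ∀ j, Y j ⟶ S} (hS : IsColimit (Cofan.mk S ι)) (x : K ⟶ S) :
    x ∈ finitaryHoms ι K := by
  let F := preadditiveCoyoneda.obj (Opposite.op K)
  have : PreservesColimitsOfShape (Discrete J) F := hK.preservesColimitsOfShape J
  have hF := isColimitCofanMkObjOfIsColimit F Y ι hS
  let q : F.obj S ⟶ AddCommGrpCat.of ((K ⟶ S) ⧸ finitaryHoms ι K) :=
    AddCommGrpCat.ofHom (QuotientAddGroup.mk' (finitaryHoms ι K))
  have hq : q = 0 := coprod_hom_ext hF (fun j ↦ by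
    ext y
    exact (QuotientAddGroup.eq_zero_iff (N := finitaryHoms ι K) _).2 (comp_ι_mem_finitaryHoms j y))
  have := ConcreteCategory.congr_hom hq x
  exact (QuotientAddGroup.eq_zero_iff (N := finitaryHoms ι K) _).1 this

/-- The map from the direct sum of the Hom groups is always injective, because the projections
recover the components; the hypothesis is exactly its surjectivity. -/
lemma nonempty_isColimit_preadditiveCoyoneda {K : C} {J : Type v} {Y : J → C} {S : C}
    {ι : ∀ j, Y j ⟶ S} (hS : IsColimit (Cofan.mk S ι))
    (h : ∀ x : K ⟶ S, x ∈ finitaryHoms ι K) :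
    Nonempty (IsColimit (Cofan.mk ((preadditiveCoyoneda.obj (Opposite.op K)).obj S)
      (fun j ↦ (preadditiveCoyoneda.obj (Opposite.op K)).map (ι j)))) := by
  classical
  let φ : DirectSum J (fun j ↦ (K ⟶ Y j)) →+ (K ⟶ S) :=
    DirectSum.toAddMonoid (fun j ↦ Preadditive.rightComp K (ι j))
  have φ_of : ∀ j (y : K ⟶ Y j), φ (DirectSum.of (fun j ↦ (K ⟶ Y j)) j y) = y ≫ ι j :=
    fun j y ↦ DirectSum.toAddMonoid_of _ _ _
  have hφ : ∀ z j, φ z ≫ coprodProj hS j = z j := fun z j ↦ by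
    induction z using DirectSum.induction_on with
    | zero => simp
    | of i y =>
      rw [φ_of, Category.assoc]
      by_cases hij : i = j
      · subst hij
        simp
      · rw [ι_coprodProj_of_ne hS hij, Limits.comp_zero, DirectSum.of_eq_of_ne _ _ _ (Ne.symm hij)]
    | add z z' hz hz' => simp [hz, hz']
  have inj : Function.Injective φ := fun z z' hz ↦ by
    refine DFinsupp.ext (fun j ↦ ?_)
    exact (hφ z j).symm.trans ((by rw [hz] : _ = _).trans (hφ z' j))
  have surj : Function.Surjective φ := fun x ↦ by
    have := h x
    induction this using AddSubgroup.closure_induction with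
    | mem x hx =>
      obtain ⟨j, y, rfl⟩ := hx
      exact ⟨_, φ_of j y⟩
    | zero => exact ⟨0, map_zero _⟩
    | add x y _ _ hx hy =>
      obtain ⟨a, rfl⟩ := hx
      obtain ⟨b, rfl⟩ := hy
      exact ⟨a + b, map_add _ _ _⟩
    | neg x _ hx =>
      obtain ⟨a, rfl⟩ := hx
      exact ⟨-a, map_neg _ _⟩
  let e := AddEquiv.ofBijective φ ⟨inj, surj⟩
  have e_of : ∀ j (y : K ⟶ Y j), e (DirectSum.of (fun j ↦ (K ⟶ Y j)) j y) = y ≫ ι j := φ_of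
  refine ⟨isColimitCofan (fun Z k ↦ ⟨AddCommGrpCat.ofHom
    ((DirectSum.toAddMonoid (fun j ↦ (k j).hom)).comp e.symm.toAddMonoidHom), ?_, ?_⟩)⟩
  · intro j
    ext y
    have : e.symm (y ≫ ι j) = DirectSum.of (fun j ↦ (K ⟶ Y j)) j y :=
      e.symm_apply_eq.2 (e_of j y).symm
    change DirectSum.toAddMonoid (fun j ↦ (k j).hom) (e.symm (y ≫ ι j)) = _
    rw [this]
    exact DirectSum.toAddMonoid_of _ _ _
  · intro a ha
    have : a.hom.comp e.toAddMonoidHom = DirectSum.toAddMonoid (fun j ↦ (k j).hom) := by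
      refine DirectSum.addHom_ext (fun i y ↦ ?_)
      refine Eq.trans ?_ (DirectSum.toAddMonoid_of (fun j ↦ (k j).hom) i y).symm
      exact (congrArg a.hom (e_of i y)).trans (ConcreteCategory.congr_hom (ha i) y)
    ext x
    obtain ⟨z, rfl⟩ := e.surjective x
    change _ = DirectSum.toAddMonoid (fun j ↦ (k j).hom) (e.symm (e z))
    rw [AddEquiv.symm_apply_apply]
    exact DFunLike.congr_fun this z

lemma compactObjects_iff {K : C} : compactObjects C K ↔
    ∀ (J : Type v) (Y : J → C) (S : C) (ι : ∀ j, Y j ⟶ S), IsColimit (Cofan.mk S ι) →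
      ∀ x : K ⟶ S, x ∈ finitaryHoms ι K := by
  refine ⟨fun h J Y S ι hS x ↦ mem_finitaryHoms_of_compact h hS x, fun h J ↦ ⟨fun {F} ↦ ?_⟩⟩
  refine ⟨fun {c} hc ↦ ?_⟩
  obtain ⟨hK⟩ := nonempty_isColimit_preadditiveCoyoneda (K := K) (isColimitCofanOfDiscrete hc)
    (h _ _ _ _ (isColimitCofanOfDiscrete hc))
  refine ⟨IsColimit.mk
    (fun s ↦ coprodDesc hK (fun j ↦ s.ι.app ⟨j⟩)) (fun s j ↦ ?_) (fun s m hm ↦ ?_)⟩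
  · exact ι_coprodDesc hK (fun j ↦ s.ι.app ⟨j⟩) j.as
  · refine coprod_hom_ext hK (fun j ↦ ?_)
    exact (hm ⟨j⟩).trans (ι_coprodDesc hK (fun j ↦ s.ι.app ⟨j⟩) j).symm

instance : (compactObjects C).IsStableUnderRetracts where
  of_retract {X Y} r hY := by
    rw [compactObjects_iff] at hY ⊢
    intro J W S ι hS x
    have := finitaryHoms_precomp r.i (hY J W S ι hS (r.r ≫ x))
    rwa [← Category.assoc, r.retract, Category.id_comp] at this

lemma compactObjects_of_isZero {X : C} (hX : IsZero X) : compactObjects C X := by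
  rw [compactObjects_iff]
  intro J W S ι hS x
  rw [hX.eq_of_src x 0]
  exact AddSubgroup.zero_mem _

end Compact

section CompactTriangulated

variable {C : Type u} [Category.{v} C] [HasShift C ℤ] [Preadditive C]
  [∀ n : ℤ, (shiftFunctor C n).Additive]

/-- Morphisms `K⟦n⟧ ⟶ S` correspond additively to morphisms `K ⟶ S⟦-n⟧`, and the inverse shift
preserves coproducts. -/
lemma compactObjects_shift {K : C} (hK : compactObjects C K) (n : ℤ) :
    compactObjects C (K⟦n⟧) := by
  have : PreservesColimitsOfSize.{v, v} (shiftFunctor C (-n)) := inferInstance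
  rw [compactObjects_iff]
  intro J Y S ι hS x
  let e := (shiftFunctorCompIsoId C n (-n) (by simp)).app K
  have hx := mem_finitaryHoms_of_compact hK
    (isColimitCofanMkObjOfIsColimit (shiftFunctor C (-n)) Y ι hS) (e.inv ≫ x⟦-n⟧')
  have key : ∀ z : K ⟶ S⟦-n⟧,
      z ∈ finitaryHoms (fun j ↦ (ι j)⟦-n⟧') K →
      ∀ x : K⟦n⟧ ⟶ S, e.inv ≫ x⟦-n⟧' = z → x ∈ finitaryHoms ι (K⟦n⟧) := by
    have cancel : ∀ {W : C} {a b : K⟦n⟧ ⟶ W}, e.inv ≫ a⟦-n⟧' = e.inv ≫ b⟦-n⟧' → a = b := by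
      intro W a b h
      exact (shiftFunctor C (-n)).map_injective ((cancel_epi _).1 h)
    have lift : ∀ {W : C} (z : K ⟶ W⟦-n⟧), ∃ a : K⟦n⟧ ⟶ W, e.inv ≫ a⟦-n⟧' = z := by
      intro W z
      exact ⟨(shiftFunctor C (-n)).preimage (e.hom ≫ z), by simp⟩
    intro z hz
    induction hz using AddSubgroup.closure_induction with
    | mem z hz =>
      obtain ⟨j, y, rfl⟩ := hz
      intro x hx
      obtain ⟨a, ha⟩ := lift y
      have : x = a ≫ ι j := cancel (by rw [hx, Functor.map_comp, ← ha, Category.assoc])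
      rw [this]
      exact comp_ι_mem_finitaryHoms j a
    | zero =>
      intro x hx
      have : x = 0 := cancel (by rw [hx]; simp)
      rw [this]
      exact AddSubgroup.zero_mem _
    | add z z' _ _ hz hz' =>
      intro x hx
      obtain ⟨a, ha⟩ := lift z
      obtain ⟨a', ha'⟩ := lift z'
      have : x = a + a' := cancel (by rw [hx, Functor.map_add, Preadditive.comp_add, ha, ha'])
      rw [this]
      exact AddSubgroup.add_mem _ (hz a ha) (hz' a' ha')
    | neg z _ hz =>
      intro x hx
      obtain ⟨a, ha⟩ := lift z
      have : x = -a := cancel (by rw [hx, Functor.map_neg, Preadditive.comp_neg, ha])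
      rw [this]
      exact AddSubgroup.neg_mem _ (hz a ha)
  exact key _ hx x rfl

variable [HasZeroObject C] [Pretriangulated C]

/-- Finitely many summands support `T.mor₁ ≫ x`. Subtracting the components of `x` in them leaves a
morphism that vanishes on the first term, hence comes from the compact third term. -/
lemma compactObjects_ext (T : Triangle C) (hT : T ∈ distTriang C)
    (h₁ : compactObjects C T.obj₁) (h₃ : compactObjects C T.obj₃) : compactObjects C T.obj₂ := by
  rw [compactObjects_iff]
  intro J Y S ι hS x
  obtain ⟨s, hs⟩ := exists_eq_sum_of_mem_finitaryHoms hS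
    (mem_finitaryHoms_of_compact h₁ hS (T.mor₁ ≫ x))
  let y := ∑ j ∈ s, (x ≫ coprodProj hS j) ≫ ι j
  have hy : y ∈ finitaryHoms ι T.obj₂ :=
    AddSubgroup.sum_mem _ (fun j _ ↦ comp_ι_mem_finitaryHoms j _)
  obtain ⟨z, hz⟩ := Triangle.yoneda_exact₂ T hT (x - y) (by
    rw [Preadditive.comp_sub, Preadditive.comp_sum, sub_eq_zero]
    simpa using hs s subset_rfl)
  have hz' := finitaryHoms_precomp T.mor₂ (mem_finitaryHoms_of_compact h₃ hS z)
  rw [← hz] at hz'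
  simpa using AddSubgroup.add_mem _ hz' hy

lemma compactObjects_isExtensionClosed : IsExtensionClosed (compactObjects C) where
  containsZero := ⟨_, isZero_zero C, compactObjects_of_isZero (isZero_zero C)⟩
  ext T hT h₁ h₃ := compactObjects_ext T hT h₁ h₃

end CompactTriangulated

/-! ### Telescope morphisms -/

section Telescope

variable {C : Type u} [Category.{v} C] [Preadditive C] {Y : ℕ → C} {f : ∀ i, Y i ⟶ Y (i + 1)}
  {S : C} {ι : ∀ i, Y i ⟶ S}

/-- An endomorphism of `S` is a telescope morphism of the sequence `f` if its restriction to the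
summand `Y i` has components the identity and `-f i`. -/
def IsTelescope (f : ∀ i, Y i ⟶ Y (i + 1)) (ι : ∀ i, Y i ⟶ S) (φ : S ⟶ S) : Prop :=
  ∀ i, ι i ≫ φ = ι i - f i ≫ ι (i + 1)

lemma IsTelescope.map {φ : S ⟶ S} (hφ : IsTelescope f ι φ) {D : Type*} [Category* D] [Preadditive D]
    (F : C ⥤ D) [F.Additive] :
    IsTelescope (fun i ↦ F.map (f i)) (fun i ↦ F.map (ι i)) (F.map φ) := fun i ↦ by
  rw [← F.map_comp, hφ i, F.map_sub, F.map_comp]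

lemma isTelescope_telescopeMap [HasCoproducts.{v} C] (f : ∀ i, Y i ⟶ Y (i + 1)) :
    IsTelescope f (Sigma.ι Y) (telescopeMap Y f) := fun i ↦ by
  simp [telescopeMap]

lemma IsTelescope.comp_coprodProj_zero {φ : S ⟶ S} (hφ : IsTelescope f ι φ)
    (hS : IsColimit (Cofan.mk S ι)) : φ ≫ coprodProj hS 0 = coprodProj hS 0 :=
  coprod_hom_ext hS (fun i ↦ by
    rw [← Category.assoc, hφ i, Preadditive.sub_comp, Category.assoc,
      ι_coprodProj_of_ne hS (Nat.succ_ne_zero i), Limits.comp_zero, sub_zero])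

lemma IsTelescope.comp_coprodProj_succ {φ : S ⟶ S} (hφ : IsTelescope f ι φ)
    (hS : IsColimit (Cofan.mk S ι)) (n : ℕ) :
    φ ≫ coprodProj hS (n + 1) = coprodProj hS (n + 1) - coprodProj hS n ≫ f n :=
  coprod_hom_ext hS (fun i ↦ by
    rw [← Category.assoc, hφ i, Preadditive.sub_comp, Preadditive.comp_sub, Category.assoc,
      ← Category.assoc (ι i) (coprodProj hS n)]
    congr 1
    by_cases h : i = n
    · subst h
      simp
    · rw [ι_coprodProj_of_ne hS h, ι_coprodProj_of_ne hS (by simpa using h)]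
      simp)

/-- The component of `x ≫ φ` at `0` is that of `x`, and at `n + 1` it is `x (n + 1) - x n ≫ f n`;
the components of `x` therefore vanish one after the other. -/
lemma IsTelescope.comp_coprodProj_eq_zero {φ : S ⟶ S} (hφ : IsTelescope f ι φ)
    (hS : IsColimit (Cofan.mk S ι)) {K : C} {x : K ⟶ S} (hx : x ≫ φ = 0) (n : ℕ) :
    x ≫ coprodProj hS n = 0 := by
  induction n with
  | zero =>
    rw [← hφ.comp_coprodProj_zero hS, ← Category.assoc, hx, Limits.zero_comp]
  | succ n hn =>
    have h := x ≫= hφ.comp_coprodProj_succ hS n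
    rw [← Category.assoc, hx, Limits.zero_comp, Preadditive.comp_sub, ← Category.assoc, hn,
      Limits.zero_comp, sub_zero] at h
    exact h.symm

end Telescope

/-! ### Exactness of Hom on distinguished triangles -/

section DistinguishedTriangles

variable {C : Type u} [Category.{v} C] [HasZeroObject C] [HasShift C ℤ] [Preadditive C]
  [∀ n : ℤ, (shiftFunctor C n).Additive] [Pretriangulated C]
  {X Y Z : C} {f : X ⟶ Y} {g : Y ⟶ Z} {h : Z ⟶ X⟦(1 : ℤ)⟧}

lemma distTriang_comp₁₂ (hT : Triangle.mk f g h ∈ distTriang C) : f ≫ g = 0 :=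
  comp_distTriang_mor_zero₁₂ _ hT

lemma distTriang_comp₂₃ (hT : Triangle.mk f g h ∈ distTriang C) : g ≫ h = 0 :=
  comp_distTriang_mor_zero₂₃ _ hT

lemma distTriang_comp₃₁ (hT : Triangle.mk f g h ∈ distTriang C) : h ≫ f⟦(1 : ℤ)⟧' = 0 :=
  comp_distTriang_mor_zero₃₁ _ hT

lemma distTriang_lift₁ (hT : Triangle.mk f g h ∈ distTriang C) {W : C} (a : W ⟶ X⟦(1 : ℤ)⟧)
    (ha : a ≫ f⟦(1 : ℤ)⟧' = 0) : ∃ b : W ⟶ Z, a = b ≫ h :=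
  Triangle.coyoneda_exact₁ _ hT a ha

lemma distTriang_lift₂ (hT : Triangle.mk f g h ∈ distTriang C) {W : C} (a : W ⟶ Y)
    (ha : a ≫ g = 0) : ∃ b : W ⟶ X, a = b ≫ f :=
  Triangle.coyoneda_exact₂ _ hT a ha

lemma distTriang_lift₃ (hT : Triangle.mk f g h ∈ distTriang C) {W : C} (a : W ⟶ Z)
    (ha : a ≫ h = 0) : ∃ b : W ⟶ Y, a = b ≫ g :=
  Triangle.coyoneda_exact₃ _ hT a ha

lemma distTriang_desc₂ (hT : Triangle.mk f g h ∈ distTriang C) {W : C} (a : Y ⟶ W)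
    (ha : f ≫ a = 0) : ∃ b : Z ⟶ W, a = g ≫ b :=
  Triangle.yoneda_exact₂ _ hT a ha

lemma distTriang_desc₃ (hT : Triangle.mk f g h ∈ distTriang C) {W : C} (a : Z ⟶ W)
    (ha : g ≫ a = 0) : ∃ b : X⟦(1 : ℤ)⟧ ⟶ W, a = h ≫ b :=
  Triangle.yoneda_exact₃ _ hT a ha

lemma distTriang_desc₁ (hT : Triangle.mk f g h ∈ distTriang C) {W : C} (a : X⟦(1 : ℤ)⟧ ⟶ W)
    (ha : h ≫ a = 0) : ∃ b : Y⟦(1 : ℤ)⟧ ⟶ W, a = f⟦(1 : ℤ)⟧' ≫ b := by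
  -- Rotation introduces the sign, which is then absorbed into `b`.
  obtain ⟨b, hb⟩ : ∃ b : Y⟦(1 : ℤ)⟧ ⟶ W, a = (-f⟦(1 : ℤ)⟧') ≫ b :=
    Triangle.yoneda_exact₃ _ (rot_of_distTriang _ hT) a ha
  exact ⟨-b, by rw [hb, Preadditive.comp_neg, Preadditive.neg_comp]⟩

lemma distTriang_complete₂ {X' Y' Z' : C} {f' : X' ⟶ Y'} {g' : Y' ⟶ Z'} {h' : Z' ⟶ X'⟦(1 : ℤ)⟧}
    (hT : Triangle.mk f g h ∈ distTriang C) (hT' : Triangle.mk f' g' h' ∈ distTriang C)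
    (a : X ⟶ X') (c : Z ⟶ Z') (comm : h ≫ a⟦(1 : ℤ)⟧' = c ≫ h') :
    ∃ b : Y ⟶ Y', f ≫ b = a ≫ f' ∧ g ≫ c = b ≫ g' :=
  complete_distinguished_triangle_morphism₂ _ _ hT hT' a c comm

lemma distTriang_of_iso₃ (hT : Triangle.mk f g h ∈ distTriang C) {Z' : C} (e : Z ≅ Z') :
    Triangle.mk f (g ≫ e.hom) (e.inv ≫ h) ∈ distTriang C := by
  have h₁ : f ≫ 𝟙 Y = 𝟙 X ≫ f := by simp
  have h₂ : (g ≫ e.hom) ≫ e.inv = 𝟙 Y ≫ g := by simp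
  have h₃ : (e.inv ≫ h) ≫ (𝟙 X)⟦(1 : ℤ)⟧' = e.inv ≫ h := by simp
  exact isomorphic_distinguished _ hT _
    (Triangle.isoMk _ _ (Iso.refl X) (Iso.refl Y) e.symm h₁ h₂ h₃)

end DistinguishedTriangles

/-! ### Homotopy colimits, compactness and orthogonals -/

section Homotopy

variable {C : Type u} [Category.{v} C] [HasZeroObject C] [HasShift C ℤ] [Preadditive C]
  [∀ n : ℤ, (shiftFunctor C n).Additive] [Pretriangulated C]
  {Y : ℕ → C} {f : ∀ i, Y i ⟶ Y (i + 1)} {S : C} {ι : ∀ i, Y i ⟶ S} {φ : S ⟶ S}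

/-- A shifted coproduct is the coproduct of the shifts. -/
noncomputable def isColimitShift {J : Type w} {Y : J → C} {S : C} {ι : ∀ i, Y i ⟶ S}
    (hS : IsColimit (Cofan.mk S ι)) (n : ℤ) :
    IsColimit (Cofan.mk (S⟦n⟧) (fun i ↦ (ι i)⟦n⟧') : Cofan (fun i ↦ (Y i)⟦n⟧)) :=
  isColimitCofanMkObjOfIsColimit (shiftFunctor C n) Y ι hS

/-- The obstruction `x ≫ h` to lifting `x` to the coproduct is killed by the shifted telescope, so
its components vanish, and compactness makes it zero. The lift is a finite sum, which can be pushed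
to a single stage. -/
lemma IsTelescope.exists_factorization (hφ : IsTelescope f ι φ) (hS : IsColimit (Cofan.mk S ι))
    {X : C} {g : S ⟶ X} {h : X ⟶ S⟦(1 : ℤ)⟧} (hT : Triangle.mk φ g h ∈ distTriang C)
    {K : C} (hK : compactObjects C K) (x : K ⟶ X) :
    ∃ (n : ℕ) (y : K ⟶ Y n), x = y ≫ ι n ≫ g := by
  have hxh : x ≫ h = 0 := by
    refine eq_zero_of_mem_finitaryHoms (isColimitShift hS 1)
      (mem_finitaryHoms_of_compact hK (isColimitShift hS 1) _) ?_
    refine (hφ.map (shiftFunctor C (1 : ℤ))).comp_coprodProj_eq_zero _ ?_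
    rw [Category.assoc, distTriang_comp₃₁ hT, Limits.comp_zero]
  obtain ⟨z, rfl⟩ := distTriang_lift₃ hT x hxh
  have hg : ∀ i, f i ≫ ι (i + 1) ≫ g = ι i ≫ g := fun i ↦ by
    have h₂ := hφ i =≫ g
    rw [Category.assoc, distTriang_comp₁₂ hT, Limits.comp_zero, Preadditive.sub_comp, Category.assoc] at h₂
    exact (sub_eq_zero.1 h₂.symm).symm
  -- Factorization at all late stages, rather than at one, is stable under addition.
  suffices ∃ n, ∀ m, n ≤ m → ∃ y : K ⟶ Y m, z ≫ g = y ≫ ι m ≫ g by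
    obtain ⟨n, hn⟩ := this
    exact ⟨n, hn n le_rfl⟩
  have hz := mem_finitaryHoms_of_compact hK hS z
  clear hxh
  induction hz using AddSubgroup.closure_induction with
  | mem z hz =>
    obtain ⟨j, y, rfl⟩ := hz
    refine ⟨j, fun m hm ↦ ?_⟩
    induction m, hm using Nat.le_induction with
    | base => exact ⟨y, by simp⟩
    | succ m hm h' =>
      obtain ⟨y', hy'⟩ := h'
      exact ⟨y' ≫ f m, by rw [hy', Category.assoc, hg]⟩
  | zero => exact ⟨0, fun m _ ↦ ⟨0, by simp⟩⟩
  | add z z' _ _ hz hz' =>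
    obtain ⟨n, hn⟩ := hz
    obtain ⟨n', hn'⟩ := hz'
    refine ⟨max n n', fun m hm ↦ ?_⟩
    obtain ⟨y, hy⟩ := hn m ((le_max_left _ _).trans hm)
    obtain ⟨y', hy'⟩ := hn' m ((le_max_right _ _).trans hm)
    exact ⟨y + y', by rw [Preadditive.add_comp, Preadditive.add_comp, hy, hy']⟩
  | neg z _ hz =>
    obtain ⟨n, hn⟩ := hz
    refine ⟨n, fun m hm ↦ ?_⟩
    obtain ⟨y, hy⟩ := hn m hm
    exact ⟨-y, by rw [Preadditive.neg_comp, Preadditive.neg_comp, hy]⟩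

lemma IsExtensionClosed.prop_sequence {P : ObjectProperty C} (hP : IsExtensionClosed P)
    (h₀ : P (Y 0)) (hf : ∀ i, ∃ Z, P Z ∧ IsCone (f i) Z) (n : ℕ) : P (Y n) := by
  induction n with
  | zero => exact h₀
  | succ n hn =>
    obtain ⟨Z, hZ, g, h, hT⟩ := hf n
    exact hP.ext _ hT hn hZ

lemma leftOrthogonal_isExtensionClosed (D : ObjectProperty C) :
    IsExtensionClosed D.leftOrthogonal where
  containsZero := inferInstance
  ext T hT h₁ h₃ := D.leftOrthogonal.ext_of_isTriangulatedClosed₂ T hT h₁ h₃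

/-- A morphism `X ⟶ W` vanishes on the coproduct, so it is `h ≫ b`. Morphisms to `W` extend along
each `(f n)⟦1⟧`, since the cones are orthogonal to `W`; hence `b` factors through the shifted
telescope, which `h` annihilates. -/
lemma leftOrthogonal_stronglyExtensionClosed [HasCoproducts.{v} C] (D : ObjectProperty C) :
    IsStronglyExtensionClosed D.leftOrthogonal where
  containsZero := inferInstance
  sequentialExtensions_le := by
    rintro X ⟨Y, f, h₀, hf, g, h, hT⟩ W a hW
    have hφ := isTelescope_telescopeMap f
    have hS := isColimitShift (coproductIsCoproduct Y) 1
    have hY : ∀ n, D.leftOrthogonal (Y n) :=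
      (leftOrthogonal_isExtensionClosed D).prop_sequence h₀ hf
    have hga : g ≫ a = 0 := Sigma.hom_ext _ _ (fun n ↦ by
      rw [hY n (Sigma.ι Y n ≫ g ≫ a) hW, Limits.comp_zero])
    obtain ⟨b, rfl⟩ := distTriang_desc₃ hT a hga
    have step : ∀ n (k : (Y n)⟦(1 : ℤ)⟧ ⟶ W), ∃ k' : (Y (n + 1))⟦(1 : ℤ)⟧ ⟶ W,
        (f n)⟦(1 : ℤ)⟧' ≫ k' = k := fun n k ↦ by
      obtain ⟨Z, hZ, p, q, hT'⟩ := hf n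
      obtain ⟨k', hk'⟩ := distTriang_desc₁ hT' k (hZ _ hW)
      exact ⟨k', hk'.symm⟩
    choose next hnext using step
    -- The recursion solves `c n - f n ≫ c (n + 1) = b n` up to shifts; the initial value is free.
    let c : ∀ n, (Y n)⟦(1 : ℤ)⟧ ⟶ W := fun n ↦
      Nat.rec 0 (fun n k ↦ next n (k - (Sigma.ι Y n)⟦(1 : ℤ)⟧' ≫ b)) n
    have hc : ∀ n, (f n)⟦(1 : ℤ)⟧' ≫ c (n + 1) = c n - (Sigma.ι Y n)⟦(1 : ℤ)⟧' ≫ b :=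
      fun n ↦ hnext n _
    have hb : (telescopeMap Y f)⟦(1 : ℤ)⟧' ≫ coprodDesc hS c = b := coprod_hom_ext hS (fun n ↦ by
      rw [← Category.assoc, hφ.map (shiftFunctor C (1 : ℤ)) n, Preadditive.sub_comp, Category.assoc,
        ι_coprodDesc hS, ι_coprodDesc hS, hc, sub_sub_cancel])
    rw [← hb, ← Category.assoc, distTriang_comp₃₁ hT, Limits.zero_comp]

lemma leftOrthogonal_isSmashingClass {C : Type u} [Category.{v} C] [Preadditive C]
    (D : ObjectProperty C) : IsSmashingClass D.leftOrthogonal := by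
  rw [isSmashingClass_iff]
  intro J Y S ι hS hY W a hW
  exact coprod_hom_ext hS (fun j ↦ by rw [hY j (ι j ≫ a) hW, Limits.comp_zero])

lemma leftOrthogonal_isStableUnderRetracts {C : Type u} [Category.{v} C] [Preadditive C]
    (D : ObjectProperty C) : D.leftOrthogonal.IsStableUnderRetracts where
  of_retract {X Y} r hY W a hW := by
    rw [← Category.id_comp a, ← r.retract, Category.assoc, hY (r.r ≫ a) hW, Limits.comp_zero]

lemma strongExtensionClosure_le [HasCoproducts.{v} C] {P Q : ObjectProperty C}
    (h₁ : IsStronglyExtensionClosed Q) (h₂ : Q.IsStableUnderRetracts) (h₃ : IsSmashingClass Q)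
    (h₄ : P ≤ Q) : strongExtensionClosure P ≤ Q :=
  sInf_le ⟨h₁, h₂, h₃, h₄⟩

lemma bigHull_le_strongExtensionClosure [HasCoproducts.{v} C] (P : ObjectProperty C) :
    bigHull P ≤ strongExtensionClosure P := by
  refine le_sInf ?_
  rintro Q ⟨h₁, h₂, h₃, h₄⟩
  rw [bigHull, ObjectProperty.retractClosure_le_iff]
  have hle := coproductClosure_le h₃ h₄
  rintro X ⟨Y, f, h₀, hf, hX⟩
  refine h₁.sequentialExtensions_le _ ⟨Y, f, hle _ h₀, fun i ↦ ?_, hX⟩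
  obtain ⟨Z, hZ, hc⟩ := hf i
  exact ⟨Z, hle _ hZ, hc⟩

lemma strongExtensionClosure_le_leftOrthogonal [HasCoproducts.{v} C] (P : ObjectProperty C) :
    strongExtensionClosure P ≤ P.rightOrthogonal.leftOrthogonal :=
  strongExtensionClosure_le (leftOrthogonal_stronglyExtensionClosed _)
    (leftOrthogonal_isStableUnderRetracts _) (leftOrthogonal_isSmashingClass _)
    (fun _ hX _ a hY ↦ hY a hX)

lemma rightOrthogonal_isSmashingClass {C : Type u} [Category.{v} C] [Preadditive C]
    {P : ObjectProperty C} (hP : P ≤ compactObjects C) : IsSmashingClass P.rightOrthogonal := by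
  rw [isSmashingClass_iff]
  intro J Y S ι hS hY K x hK
  exact eq_zero_of_mem_finitaryHoms hS (mem_finitaryHoms_of_compact (hP _ hK) hS x)
    (fun j ↦ hY j _ hK)

end Homotopy

/-! ### The small object argument and the generated torsion theory -/

section Decomposition

variable {C : Type u} [Category.{v} C]

lemma coproductClosure_isSmashingClass (P : ObjectProperty C) :
    IsSmashingClass (coproductClosure P) :=
  fun J ↦ inferInstanceAs
    ((P.colimitsClosure (fun J : Type v ↦ Discrete J)).IsClosedUnderColimitsOfShape (Discrete J))

lemma exists_coproduct_cover [HasCoproducts.{v} C] (P : ObjectProperty C)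
    [ObjectProperty.Small.{v} P] (N : C) :
    ∃ (Z : C) (q : Z ⟶ N), coproductClosure P Z ∧
      ∀ K, P K → ∀ x : K ⟶ N, ∃ y : K ⟶ Z, y ≫ q = x := by
  let e := equivShrink.{v} (Subtype P)
  let J : Type v := Σ p : Shrink.{v} (Subtype P), ((e.symm p).1 ⟶ N)
  let Y : J → C := fun j ↦ (e.symm j.1).1
  refine ⟨∐ Y, Sigma.desc (fun j ↦ j.2), ?_, fun K hK x ↦ ?_⟩
  · exact isSmashingClass_iff.1 (coproductClosure_isSmashingClass P) J Y _ _
      (coproductIsCoproduct Y) (fun j ↦ P.le_colimitsClosure _ _ (e.symm j.1).2)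
  · obtain ⟨p, hp⟩ := e.symm.surjective ⟨K, hK⟩
    obtain rfl : (e.symm p).1 = K := congrArg Subtype.val hp
    exact ⟨Sigma.ι Y ⟨p, x⟩, by simp [Y]⟩

variable [HasZeroObject C] [HasShift C ℤ] [Preadditive C]
  [∀ n : ℤ, (shiftFunctor C n).Additive] [Pretriangulated C]

lemma TorsionTheory.ext_of_isGeneratedBy {s s' : TorsionTheory C} {P : ObjectProperty C}
    (h : s.IsGeneratedBy P) (h' : s'.IsGeneratedBy P) : s' = s := by
  have hr : s'.right = s.right := h'.symm.trans h
  refine TorsionTheory.ext ?_ hr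
  rw [← s.leftOrthogonal_right, ← s'.leftOrthogonal_right, hr]

variable [HasCoproducts.{v} C]

/-- A morphism `K ⟶ L⟦1⟧` that dies in `M⟦1⟧` comes from the cone `N` of `a`, hence from its cover
`Z`. Taking `Z ⟶ N ⟶ L⟦1⟧` as the connecting morphism of the extension `L'` kills it. -/
lemma exists_cell_attachment (P : ObjectProperty C) [ObjectProperty.Small.{v} P] {L M : C}
    (a : L ⟶ M) :
    ∃ (L' : C) (i : L ⟶ L') (a' : L' ⟶ M), i ≫ a' = a ∧
      (∃ Z, coproductClosure P Z ∧ IsCone i Z) ∧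
      ∀ K, P K → ∀ x : K ⟶ L⟦(1 : ℤ)⟧, x ≫ a⟦(1 : ℤ)⟧' = 0 → x ≫ i⟦(1 : ℤ)⟧' = 0 := by
  obtain ⟨N, b, d, hN⟩ := distinguished_cocone_triangle a
  obtain ⟨Z, q, hZ, hq⟩ := exists_coproduct_cover P N
  obtain ⟨L', i, r, hL'⟩ := distinguished_cocone_triangle₂ (q ≫ d)
  obtain ⟨a', ha', _⟩ := distTriang_complete₂ hL' hN (𝟙 L) q (by simp)
  refine ⟨L', i, a', by simpa using ha', ⟨Z, hZ, r, _, hL'⟩, fun K hK x hx ↦ ?_⟩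
  obtain ⟨y, rfl⟩ := distTriang_lift₁ hN x hx
  obtain ⟨z, rfl⟩ := hq K hK y
  have := distTriang_comp₃₁ hL'
  rw [Category.assoc] at this ⊢
  rw [Category.assoc, this, Limits.comp_zero]

lemma exists_decomposition {P : ObjectProperty C} [ObjectProperty.Small.{v} P]
    (hP : P ≤ compactObjects C) (M : C) :
    ∃ (L R : C) (a : L ⟶ M) (n : M ⟶ R) (d : R ⟶ L⟦(1 : ℤ)⟧),
      Triangle.mk a n d ∈ distTriang C ∧ naiveBigHull P L ∧ P.rightOrthogonal R := by
  obtain ⟨Y₀, a₀, hY₀, ha₀⟩ := exists_coproduct_cover P M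
  choose next i a' ha' hi hkill using
    fun (s : Σ L : C, (L ⟶ M)) ↦ exists_cell_attachment P s.2
  let s : ℕ → Σ L : C, (L ⟶ M) := fun n ↦ Nat.rec ⟨Y₀, a₀⟩ (fun _ s ↦ ⟨next s, a' s⟩) n
  let Y : ℕ → C := fun n ↦ (s n).1
  let α : ∀ n, Y n ⟶ M := fun n ↦ (s n).2
  let f : ∀ n, Y n ⟶ Y (n + 1) := fun n ↦ i (s n)
  have hα : ∀ n, f n ≫ α (n + 1) = α n := fun n ↦ ha' (s n)
  have hf : ∀ n, ∃ Z, coproductClosure P Z ∧ IsCone (f n) Z := fun n ↦ hi (s n)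
  have hfk : ∀ n K, P K → ∀ x : K ⟶ (Y n)⟦(1 : ℤ)⟧, x ≫ (α n)⟦(1 : ℤ)⟧' = 0 →
      x ≫ (f n)⟦(1 : ℤ)⟧' = 0 := fun n ↦ hkill (s n)
  obtain ⟨L, g, h, hL⟩ := distinguished_cocone_triangle (telescopeMap Y f)
  have hφ := isTelescope_telescopeMap f
  obtain ⟨a, ha⟩ := distTriang_desc₂ hL (Sigma.desc α) (Sigma.hom_ext _ _ (fun n ↦ by
    rw [← Category.assoc, hφ n]
    simp [hα]))
  have hga : ∀ n, Sigma.ι Y n ≫ g ≫ a = α n := fun n ↦ by simp [← ha]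
  have hshift : ∀ n, (f n)⟦(1 : ℤ)⟧' ≫ (Sigma.ι Y (n + 1))⟦(1 : ℤ)⟧' ≫ g⟦(1 : ℤ)⟧' =
      (Sigma.ι Y n)⟦(1 : ℤ)⟧' ≫ g⟦(1 : ℤ)⟧' := fun n ↦ by
    have h₂ := hφ n =≫ g
    rw [Category.assoc, distTriang_comp₁₂ hL, Limits.comp_zero, Preadditive.sub_comp] at h₂
    simp only [← Functor.map_comp]
    rw [sub_eq_zero.1 h₂.symm, Category.assoc]
  obtain ⟨R, n, d, hR⟩ := distinguished_cocone_triangle a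
  refine ⟨L, R, a, n, d, hR, ⟨Y, f, hY₀, hf, g, h, hL⟩, fun K x hK ↦ ?_⟩
  -- The morphism `x ≫ d` comes from some `(Y m)⟦1⟧` and dies in `M⟦1⟧`, hence dies one stage later.
  have hxd : x ≫ d = 0 := by
    let e := (shiftFunctorCompIsoId C (-1 : ℤ) 1 (by simp)).app K
    obtain ⟨x', hx'⟩ := (shiftFunctor C (1 : ℤ)).map_surjective (e.hom ≫ x ≫ d)
    obtain ⟨m, y, hy⟩ := hφ.exists_factorization (coproductIsCoproduct Y) hL
      (compactObjects_shift (hP _ hK) (-1)) x'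
    have hxd : x ≫ d = (e.inv ≫ y⟦(1 : ℤ)⟧') ≫ (Sigma.ι Y m)⟦(1 : ℤ)⟧' ≫ g⟦(1 : ℤ)⟧' := by
      rw [Category.assoc, ← Functor.map_comp, ← Functor.map_comp, ← hy, hx']
      simp
    have hz := hfk m K hK (e.inv ≫ y⟦(1 : ℤ)⟧') (by
      rw [← hga m, Functor.map_comp, Functor.map_comp]
      have := hxd =≫ a⟦(1 : ℤ)⟧'
      rw [Category.assoc x, distTriang_comp₃₁ hR, Limits.comp_zero] at this
      simpa only [Category.assoc] using this.symm)
    rw [hxd, ← hshift, ← Category.assoc, hz, Limits.zero_comp]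
  obtain ⟨y, rfl⟩ := distTriang_lift₃ hR x hxd
  -- Now `x` comes from `M`, and every morphism `K ⟶ M` factors through `Y 0`, hence through `L`.
  obtain ⟨z, rfl⟩ := ha₀ K hK y
  have h₀ : a₀ = Sigma.ι Y 0 ≫ g ≫ a := (hga 0).symm
  rw [h₀]
  simp only [Category.assoc]
  rw [distTriang_comp₁₂ hR]
  simp

lemma leftOrthogonal_le_bigHull {P : ObjectProperty C} [ObjectProperty.Small.{v} P]
    (hP : P ≤ compactObjects C) : P.rightOrthogonal.leftOrthogonal ≤ bigHull P := by
  intro M hM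
  obtain ⟨L, R, a, n, d, hT, hL, hR⟩ := exists_decomposition hP M
  obtain ⟨b, hb⟩ := distTriang_lift₂ hT (𝟙 M) (by rw [Category.id_comp, hM n hR])
  exact ⟨L, hL, ⟨⟨b, a, hb.symm⟩⟩⟩

lemma strongExtensionClosure_eq_leftOrthogonal {P : ObjectProperty C} [ObjectProperty.Small.{v} P]
    (hP : P ≤ compactObjects C) :
    strongExtensionClosure P = P.rightOrthogonal.leftOrthogonal :=
  le_antisymm (strongExtensionClosure_le_leftOrthogonal P)
    ((leftOrthogonal_le_bigHull hP).trans (bigHull_le_strongExtensionClosure P))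

lemma bigHull_eq_leftOrthogonal {P : ObjectProperty C} [ObjectProperty.Small.{v} P]
    (hP : P ≤ compactObjects C) : bigHull P = P.rightOrthogonal.leftOrthogonal :=
  le_antisymm ((bigHull_le_strongExtensionClosure P).trans
    (strongExtensionClosure_le_leftOrthogonal P)) (leftOrthogonal_le_bigHull hP)

lemma rightOrthogonal_leftOrthogonal_rightOrthogonal {C : Type u} [Category.{v} C]
    [Preadditive C] (P : ObjectProperty C) :
    P.rightOrthogonal.leftOrthogonal.rightOrthogonal = P.rightOrthogonal :=
  le_antisymm (fun _ hY _ x hX ↦ hY x (fun _ a hZ ↦ hZ a hX)) (fun _ hY _ x hX ↦ hX x hY)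

/-- The torsion theory generated by a set of compact objects. -/
def generatedTorsionTheory (P : ObjectProperty C) [ObjectProperty.Small.{v} P]
    (hP : P ≤ compactObjects C) : TorsionTheory C where
  left := strongExtensionClosure P
  right := P.rightOrthogonal
  rightOrthogonal_left := by
    rw [strongExtensionClosure_eq_leftOrthogonal hP, rightOrthogonal_leftOrthogonal_rightOrthogonal]
  leftOrthogonal_right := (strongExtensionClosure_eq_leftOrthogonal hP).symm
  exists_triangle M := by
    obtain ⟨L, R, a, n, d, hT, hL, hR⟩ := exists_decomposition hP M
    exact ⟨L, R, a, n, d, hT,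
      bigHull_le_strongExtensionClosure P _ (ObjectProperty.le_retractClosure _ _ hL), hR⟩

lemma sequentialExtensions_of_iso {P : ObjectProperty C} {X X' : C} (e : X ≅ X')
    (hX : sequentialExtensions P X) : sequentialExtensions P X' := by
  obtain ⟨Y, f, h₀, hf, g, h, hT⟩ := hX
  exact ⟨Y, f, h₀, hf, g ≫ e.hom, e.inv ≫ h, distTriang_of_iso₃ hT e⟩

lemma TorsionTheory.left_eq_naiveBigHull_of_isAssociatedWith {P : ObjectProperty C}
    [ObjectProperty.Small.{v} P] (hP : P ≤ compactObjects C) {s : TorsionTheory C}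
    (hs : s.IsGeneratedBy P) {t : TStructure C} (ht : s.IsAssociatedWith t) :
    s.left = naiveBigHull P := by
  have hleft : s.left = P.rightOrthogonal.leftOrthogonal := by rw [← s.leftOrthogonal_right, hs]
  have hle : naiveBigHull P ≤ s.left := by
    rw [hleft, ← bigHull_eq_leftOrthogonal hP]
    exact ObjectProperty.le_retractClosure _
  refine le_antisymm (fun M hM ↦ ?_) hle
  obtain ⟨L, R, a, n, d, hT, hL, hR⟩ := exists_decomposition hP M
  have hLs : s.left (L⟦(1 : ℤ)⟧) := by
    have := hle _ hL
    rw [← ht.1] at this ⊢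
    -- The shift sends `t.le 0` to `t.le (-1)`, which is contained in `t.le 0`.
    exact t.le_monotone (by lia) _ (t.le_shift 0 1 (-1) (by lia) _ this)
  have hn : n = 0 := by
    rw [hleft] at hM
    exact hM n hR
  have hd : Mono d := (Triangle.mor₂_eq_zero_iff_mono₃ _ hT).1 hn
  obtain ⟨r, hr⟩ := distTriang_desc₃ hT (𝟙 R) (by rw [hn, Limits.zero_comp])
  have hr0 : r = 0 := by
    rw [hleft] at hLs
    exact hLs r hR
  have hR0 : IsZero R := by
    rw [IsZero.iff_id_eq_zero, hr, hr0, Limits.comp_zero]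
  have : IsIso a := (Triangle.isZero₃_iff_isIso₁ _ hT).1 hR0
  exact sequentialExtensions_of_iso (asIso a) hL

end Decomposition

/-! ### Factoring morphisms from compact objects -/

section Factorizations

variable {C : Type u} [Category.{v} C]

/-- The morphism `x` factors through an object of the class `E`. -/
def FactorsThroughClass (E : ObjectProperty C) {K X : C} (x : K ⟶ X) : Prop :=
  ∃ (W : C) (a : K ⟶ W) (b : W ⟶ X), E W ∧ x = a ≫ b

lemma FactorsThroughClass.comp {E : ObjectProperty C} {K X X' : C} {x : K ⟶ X}
    (hx : FactorsThroughClass E x) (y : X ⟶ X') : FactorsThroughClass E (x ≫ y) := by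
  obtain ⟨W, a, b, hW, rfl⟩ := hx
  exact ⟨W, a, b ≫ y, hW, Category.assoc _ _ _⟩

/-- The class of objects `X` such that all morphisms from compact objects to `X` factor through
objects of the class `E`. -/
def compactlyApproximated [Preadditive C] (E : ObjectProperty C) : ObjectProperty C :=
  fun X ↦ ∀ ⦃K : C⦄, compactObjects C K → ∀ x : K ⟶ X, FactorsThroughClass E x

lemma FactorsThroughClass.neg [Preadditive C] {E : ObjectProperty C} {K X : C} {x : K ⟶ X}
    (hx : FactorsThroughClass E x) : FactorsThroughClass E (-x) := by
  obtain ⟨W, a, b, hW, rfl⟩ := hx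
  exact ⟨W, -a, b, hW, by simp⟩

lemma le_compactlyApproximated [Preadditive C] (E : ObjectProperty C) :
    E ≤ compactlyApproximated E :=
  fun X hX _ _ x ↦ ⟨X, x, 𝟙 X, hX, (Category.comp_id x).symm⟩

lemma compactlyApproximated_isStableUnderRetracts [Preadditive C] (E : ObjectProperty C) :
    (compactlyApproximated E).IsStableUnderRetracts where
  of_retract {X Y} r hY K hK x := by
    simpa using (hY hK (x ≫ r.i)).comp r.r

variable [HasShift C ℤ] [Preadditive C] [∀ n : ℤ, (shiftFunctor C n).Additive]
  {E : ObjectProperty C}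

/-- The shift is moved to `K`, because compactness is shift-invariant while `E` need not be. -/
lemma compactlyApproximated_shift {X : C} (hX : compactlyApproximated E X) {K : C}
    (hK : compactObjects C K) (x : K ⟶ X⟦(1 : ℤ)⟧) :
    ∃ (W : C) (a : K ⟶ W⟦(1 : ℤ)⟧) (b : W ⟶ X), E W ∧ x = a ≫ b⟦(1 : ℤ)⟧' := by
  let e := (shiftFunctorCompIsoId C (-1 : ℤ) 1 (by simp)).app K
  obtain ⟨x', hx'⟩ := (shiftFunctor C (1 : ℤ)).map_surjective (e.hom ≫ x)
  obtain ⟨W, a, b, hW, rfl⟩ := hX (compactObjects_shift hK (-1)) x'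
  refine ⟨W, e.inv ≫ a⟦(1 : ℤ)⟧', b, hW, ?_⟩
  rw [Category.assoc, ← Functor.map_comp, hx']
  simp

variable [HasZeroObject C] [Pretriangulated C]

lemma IsExtensionClosed.prop_biprod (hE : IsExtensionClosed E) {W W' : C} (hW : E W) (hW' : E W') :
    E (W ⊞ W') :=
  hE.ext _ (binaryBiproductTriangle_distinguished W W') hW hW'

lemma FactorsThroughClass.zero (hE : IsExtensionClosed E) (K X : C) :
    FactorsThroughClass E (0 : K ⟶ X) := by
  obtain ⟨Z, _, hZ⟩ := hE.containsZero.exists_zero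
  exact ⟨Z, 0, 0, hZ, by simp⟩

lemma FactorsThroughClass.add (hE : IsExtensionClosed E) {K X : C} {x y : K ⟶ X}
    (hx : FactorsThroughClass E x) (hy : FactorsThroughClass E y) :
    FactorsThroughClass E (x + y) := by
  obtain ⟨W, a, b, hW, rfl⟩ := hx
  obtain ⟨W', a', b', hW', rfl⟩ := hy
  exact ⟨W ⊞ W', biprod.lift a a', biprod.desc b b', hE.prop_biprod hW hW', by simp⟩

lemma compactlyApproximated_isSmashingClass (hE : IsExtensionClosed E) :
    IsSmashingClass (compactlyApproximated E) := by
  rw [isSmashingClass_iff]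
  intro J Y S ι hS hY K hK x
  have hx := mem_finitaryHoms_of_compact hK hS x
  induction hx using AddSubgroup.closure_induction with
  | mem x hx =>
    obtain ⟨j, y, rfl⟩ := hx
    exact (hY j hK y).comp (ι j)
  | zero => exact .zero hE _ _
  | add x y _ _ hx hy => exact hx.add hE hy
  | neg x _ hx => exact hx.neg

/-- Since `k` kills `d` after a shift, `d` extends over the extension `Q` of `K` by `X'` classified
by `k`. This `Q` is compact, so the extended morphism factors through `E`, and `k` dies already in
`Q⟦1⟧`. -/
lemma exists_factorization_annihilating {X : C} (hX : compactlyApproximated E X) {K X' : C}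
    (hK : compactObjects C K) (hX' : compactObjects C X') (k : K ⟶ X'⟦(1 : ℤ)⟧) (d : X' ⟶ X)
    (hkd : k ≫ d⟦(1 : ℤ)⟧' = 0) :
    ∃ (W : C) (i : X' ⟶ W) (d' : W ⟶ X), E W ∧ i ≫ d' = d ∧ k ≫ i⟦(1 : ℤ)⟧' = 0 := by
  obtain ⟨Q, p, q, hQ⟩ := distinguished_cocone_triangle₂ k
  obtain ⟨b, hb⟩ := distTriang_desc₁ hQ _ hkd
  obtain ⟨b, rfl⟩ := (shiftFunctor C (1 : ℤ)).map_surjective b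
  obtain rfl : d = p ≫ b := (shiftFunctor C (1 : ℤ)).map_injective (by rw [hb, Functor.map_comp])
  obtain ⟨W, i, d', hW, rfl⟩ : ∃ (W : C) (i : Q ⟶ W) (d' : W ⟶ X), E W ∧ b = i ≫ d' :=
    hX (compactObjects_ext _ hQ hX' hK) b
  refine ⟨W, p ≫ i, d', hW, Category.assoc _ _ _, ?_⟩
  rw [Functor.map_comp, ← Category.assoc, distTriang_comp₃₁ hQ, Limits.zero_comp]

/-- Factor `x ≫ g` through `W` in `E`, and `W ⟶ X⟦1⟧` through some `X'⟦1⟧`. After enlarging `X'` to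
kill the obstruction, `K ⟶ W` lifts to an extension `Y''` of `W` by an object of `E`. The error `x -
a' ≫ β` comes from `X`, where the hypothesis applies again. -/
lemma compactlyApproximated_ext (hE : IsExtensionClosed E) (hEc : E ≤ compactObjects C)
    {X Y Z : C} {f : X ⟶ Y} {g : Y ⟶ Z} {h : Z ⟶ X⟦(1 : ℤ)⟧}
    (hT : Triangle.mk f g h ∈ distTriang C)
    (hX : compactlyApproximated E X) (hZ : compactlyApproximated E Z) :
    compactlyApproximated E Y := by
  intro K hK x
  obtain ⟨W, a, b, hW, hab⟩ := hZ hK (x ≫ g)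
  obtain ⟨X', c, d, hX', hcd⟩ := compactlyApproximated_shift hX (hEc _ hW) (b ≫ h)
  obtain ⟨X'', i, d', hX'', rfl, hi⟩ := exists_factorization_annihilating hX hK (hEc _ hX')
    (a ≫ c) d (by
      rw [Category.assoc, ← hcd, ← Category.assoc, ← hab, Category.assoc, distTriang_comp₂₃ hT,
        Limits.comp_zero])
  obtain ⟨Y'', f'', g'', hT''⟩ := distinguished_cocone_triangle₂ (c ≫ i⟦(1 : ℤ)⟧')
  obtain ⟨β, _, hβ⟩ := distTriang_complete₂ hT'' hT d' b (by
    rw [Category.assoc, ← Functor.map_comp, hcd])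
  obtain ⟨a', ha'⟩ := distTriang_lift₃ hT'' a (by rw [← Category.assoc, hi])
  obtain ⟨e, he⟩ := distTriang_lift₂ hT (x - a' ≫ β) (by
    rw [Preadditive.sub_comp, Category.assoc, ← hβ, ← Category.assoc, ← ha', hab, sub_self])
  have h₁ : FactorsThroughClass E (a' ≫ β) := ⟨Y'', a', β, hE.ext _ hT'' hX'' hW, rfl⟩
  have h₂ := ((hX hK e).comp f).add hE h₁
  rwa [← he, sub_add_cancel] at h₂

lemma compactlyApproximated_isExtensionClosed (hE : IsExtensionClosed E)
    (hEc : E ≤ compactObjects C) : IsExtensionClosed (compactlyApproximated E) where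
  containsZero := ⟨_, isZero_zero C, fun K _ x ↦ by
    rw [(isZero_zero C).eq_of_tgt x 0]
    exact .zero hE _ _⟩
  ext _ hT h₁ h₃ := compactlyApproximated_ext hE hEc hT h₁ h₃

lemma compactlyApproximated_stronglyExtensionClosed [HasCoproducts.{v} C]
    (hE : IsExtensionClosed E) (hEc : E ≤ compactObjects C) :
    IsStronglyExtensionClosed (compactlyApproximated E) where
  containsZero := (compactlyApproximated_isExtensionClosed hE hEc).containsZero
  sequentialExtensions_le := by
    rintro X ⟨Y, f, h₀, hf, g, h, hT⟩ K hK x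
    obtain ⟨n, y, rfl⟩ := (isTelescope_telescopeMap f).exists_factorization
      (coproductIsCoproduct Y) hT hK x
    exact ((compactlyApproximated_isExtensionClosed hE hEc).prop_sequence h₀ hf n hK y).comp _

end Factorizations

/-! ### The envelope: compact objects and essential smallness -/

section Envelope

open ZeroObject

variable {C : Type u} [Category.{v} C] [HasZeroObject C] [HasShift C ℤ] [Preadditive C]
  [∀ n : ℤ, (shiftFunctor C n).Additive] [Pretriangulated C]

lemma le_envelope (P : ObjectProperty C) : P ≤ envelope P :=
  le_sInf (fun _ hQ ↦ hQ.2.2)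

lemma envelope_le {P Q : ObjectProperty C} (h₁ : Q.IsStableUnderRetracts)
    (h₂ : IsExtensionClosed Q) (h₃ : P ≤ Q) : envelope P ≤ Q :=
  sInf_le ⟨h₁, h₂, h₃⟩

lemma sInf_prop_iff {C : Type u} [Category.{v} C] {S : Set (ObjectProperty C)} {X : C} :
    sInf S X ↔ ∀ Q ∈ S, Q X := by
  simp [sInf_apply]

instance envelope_isStableUnderRetracts (P : ObjectProperty C) :
    (envelope P).IsStableUnderRetracts where
  of_retract {X Y} r hY := by
    rw [envelope, sInf_prop_iff] at hY ⊢
    intro Q hQ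
    have := hQ.1
    exact Q.prop_of_retract r (hY Q hQ)

lemma envelope_isExtensionClosed (P : ObjectProperty C) : IsExtensionClosed (envelope P) where
  containsZero := ⟨_, isZero_zero C, by
    rw [envelope, sInf_prop_iff]
    intro Q hQ
    have := hQ.1
    have := hQ.2.1.containsZero
    exact Q.prop_of_isZero (isZero_zero C)⟩
  ext T hT h₁ h₃ := by
    rw [envelope, sInf_prop_iff] at h₁ h₃ ⊢
    exact fun Q hQ ↦ hQ.2.1.ext T hT (h₁ Q hQ) (h₃ Q hQ)

lemma envelope_le_compactObjects {P : ObjectProperty C} (hP : P ≤ compactObjects C) :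
    envelope P ≤ compactObjects C :=
  envelope_le inferInstance compactObjects_isExtensionClosed hP

lemma strongExtensionClosure_inf_compactObjects [HasCoproducts.{v} C] {P : ObjectProperty C}
    [ObjectProperty.Small.{v} P]
    (hP : P ≤ compactObjects C) :
    strongExtensionClosure P ⊓ compactObjects C = envelope P := by
  refine le_antisymm ?_ (le_inf ?_ (envelope_le_compactObjects hP))
  · rintro M ⟨hM, hMc⟩
    have hE := envelope_isExtensionClosed P
    have hle : strongExtensionClosure P ≤ compactlyApproximated (envelope P) :=
      strongExtensionClosure_le
        (compactlyApproximated_stronglyExtensionClosed hE (envelope_le_compactObjects hP))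
        (compactlyApproximated_isStableUnderRetracts _)
        (compactlyApproximated_isSmashingClass hE)
        ((le_envelope P).trans (le_compactlyApproximated _))
    obtain ⟨W, a, b, hW, hab⟩ := hle _ hM hMc (𝟙 M)
    exact (envelope P).prop_of_retract ⟨a, b, hab.symm⟩ hW
  · rw [strongExtensionClosure_eq_leftOrthogonal hP]
    exact envelope_le (leftOrthogonal_isStableUnderRetracts _) (leftOrthogonal_isExtensionClosed _)
      (fun _ hX _ a hY ↦ hY a hX)

/-- The middle term of a triangle is determined up to isomorphism by the connecting morphism, and
these form a small set. -/
lemma essentiallySmall_extensionProduct_of_small (P Q : ObjectProperty C) [ObjectProperty.Small.{v} P]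
    [ObjectProperty.Small.{v} Q] :
    ObjectProperty.EssentiallySmall.{v} (P.extensionProduct Q) := by
  let J := Σ (X : Subtype P) (Z : Subtype Q), (Z.1 ⟶ X.1⟦(1 : ℤ)⟧)
  choose Y f g hT using fun (j : J) ↦ distinguished_cocone_triangle₂ j.2.2
  refine ⟨.ofObj Y, inferInstance, ?_⟩
  rintro X ⟨X₁, X₃, f', g', h', hT', h₁, h₃⟩
  let j : J := ⟨⟨X₁, h₁⟩, ⟨X₃, h₃⟩, h'⟩
  obtain ⟨b, hb₁, hb₂⟩ := distTriang_complete₂ hT' (hT j) (𝟙 X₁) (𝟙 X₃) (by simp [j])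
  let φ : Triangle.mk f' g' h' ⟶ Triangle.mk (f j) (g j) j.2.2 :=
    Triangle.homMk _ _ (𝟙 X₁) b (𝟙 X₃) hb₁ hb₂ (by
      change h' ≫ (𝟙 X₁)⟦(1 : ℤ)⟧' = 𝟙 X₃ ≫ h'
      simp)
  have : IsIso b := isIso₂_of_isIso₁₃ φ hT' (hT j)
    (inferInstanceAs (IsIso (𝟙 X₁))) (inferInstanceAs (IsIso (𝟙 X₃)))
  exact ⟨_, ⟨j⟩, ⟨asIso b⟩⟩

instance essentiallySmall_extensionProduct (P Q : ObjectProperty C)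
    [ObjectProperty.EssentiallySmall.{v} P] [ObjectProperty.EssentiallySmall.{v} Q] :
    ObjectProperty.EssentiallySmall.{v} (P.extensionProduct Q) := by
  obtain ⟨P', _, hP'⟩ := ObjectProperty.EssentiallySmall.exists_small_le' P
  obtain ⟨Q', _, hQ'⟩ := ObjectProperty.EssentiallySmall.exists_small_le' Q
  have := essentiallySmall_extensionProduct_of_small P' Q'
  refine ObjectProperty.EssentiallySmall.of_le (Q := P'.extensionProduct Q') ?_
  refine (ObjectProperty.monotone_extensionProduct_left _ hP').trans ?_
  refine (ObjectProperty.monotone_extensionProduct_right _ hQ').trans ?_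
  rw [ObjectProperty.extensionProduct_isoClosure_left,
    ObjectProperty.extensionProduct_isoClosure_right]

/-- The iterated closures of a class under retracts and extensions. -/
def envelopeIter (P : ObjectProperty C) : ℕ → ObjectProperty C
  -- Adjoining a zero object makes the stages increasing.
  | 0 => P ⊔ .ofObj (fun _ : Unit ↦ (0 : C))
  | n + 1 => ((envelopeIter P n).extensionProduct (envelopeIter P n)).retractClosure

lemma envelopeIter_containsZero (P : ObjectProperty C) (n : ℕ) : (envelopeIter P n).ContainsZero := by
  induction n with
  | zero => exact ⟨0, isZero_zero C, Or.inr ⟨()⟩⟩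
  | succ n hn =>
    obtain ⟨Z, hZ, hZ'⟩ := hn.exists_zero
    exact ⟨Z, hZ, ObjectProperty.le_retractClosure _ _
      (ObjectProperty.le_extensionProduct_left _ _ hZ')⟩

lemma monotone_envelopeIter (P : ObjectProperty C) : Monotone (envelopeIter P) :=
  monotone_nat_of_le_succ (fun n ↦ by
    have := envelopeIter_containsZero P n
    exact (ObjectProperty.le_extensionProduct_left _).trans (ObjectProperty.le_retractClosure _))

lemma essentiallySmall_envelopeIter (P : ObjectProperty C) [ObjectProperty.Small.{v} P] (n : ℕ) :
    ObjectProperty.EssentiallySmall.{v} (envelopeIter P n) := by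
  induction n with
  | zero => rw [envelopeIter]; infer_instance
  | succ n hn => rw [envelopeIter]; infer_instance

lemma envelope_le_iSup_envelopeIter (P : ObjectProperty C) :
    envelope P ≤ ⨆ n, envelopeIter P n := by
  refine envelope_le ⟨fun {X Y} r hY ↦ ?_⟩ ⟨⟨_, isZero_zero C, ?_⟩, fun T hT h₁ h₃ ↦ ?_⟩
    (le_sup_left.trans (le_iSup (envelopeIter P) 0))
  · simp only [ObjectProperty.prop_iSup_iff] at hY ⊢
    obtain ⟨n, hn⟩ := hY
    refine ⟨n + 1, Y, ?_, ⟨r⟩⟩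
    have := envelopeIter_containsZero P n
    exact ObjectProperty.le_extensionProduct_left _ _ hn
  · simp only [ObjectProperty.prop_iSup_iff]
    exact ⟨0, Or.inr ⟨()⟩⟩
  · simp only [ObjectProperty.prop_iSup_iff] at h₁ h₃ ⊢
    obtain ⟨n, hn⟩ := h₁
    obtain ⟨m, hm⟩ := h₃
    exact ⟨max n m + 1, ObjectProperty.le_retractClosure _ _
      ⟨_, _, T.mor₁, T.mor₂, T.mor₃, hT, monotone_envelopeIter P (le_max_left n m) _ hn,
        monotone_envelopeIter P (le_max_right n m) _ hm⟩⟩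

lemma essentiallySmall_envelope (P : ObjectProperty C) [ObjectProperty.Small.{v} P] :
    ObjectProperty.EssentiallySmall.{v} (envelope P) := by
  have := essentiallySmall_envelopeIter P
  exact ObjectProperty.EssentiallySmall.of_le (envelope_le_iSup_envelopeIter P)

end Envelope

/-! ### Telescopes on products and limits of epimorphisms -/

section SequentialLimits

variable {A : Type u'} [Category.{v'} A] [Abelian A]

lemma exists_iterated_pullback {S : A} {E : ℕ → A} (e : ∀ n, E (n + 1) ⟶ E n) [∀ n, Epi (e n)]
    (π : ∀ n, S ⟶ E n) :
    ∃ (Q : ℕ → A) (p : ∀ n, Q (n + 1) ⟶ Q n) (q : ∀ n, Q n ⟶ S) (r : ∀ n, Q n ⟶ E n),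
      (∀ n, Epi (p n)) ∧ Epi (q 0) ∧ (∀ n, q (n + 1) = p n ≫ q n) ∧
      ∀ n, r (n + 1) ≫ e n = p n ≫ (r n - q n ≫ π n) := by
  let s : ∀ n : ℕ, Σ Q : A, (Q ⟶ S) × (Q ⟶ E n) := fun n ↦ Nat.rec ⟨S, 𝟙 S, 0⟩
    (fun n t ↦ ⟨pullback (t.2.2 - t.2.1 ≫ π n) (e n), pullback.fst _ _ ≫ t.2.1,
      pullback.snd _ _⟩) n
  refine ⟨fun n ↦ (s n).1, fun n ↦ pullback.fst ((s n).2.2 - (s n).2.1 ≫ π n) (e n),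
    fun n ↦ (s n).2.1, fun n ↦ (s n).2.2, fun n ↦ inferInstance, ?_, fun n ↦ rfl, fun n ↦ ?_⟩
  · exact inferInstanceAs (Epi (𝟙 S))
  · exact pullback.condition.symm

/-- Solving `a n - e n (a (n + 1)) = π n s` recursively from `a 0 = 0` requires a lift through `e n`
at each step, hence a further epimorphic cover of `S`. The limit of these covers still maps
epimorphically to `S`, and this map factors through `φ`. -/
lemma epi_of_sequentialLimitsOfEpis (hA : SequentialLimitsOfEpis A) [HasLimitsOfShape ℕᵒᵖ A]
    {S : A} {E : ℕ → A} (e : ∀ n, E (n + 1) ⟶ E n) [∀ n, Epi (e n)] (π : ∀ n, S ⟶ E n)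
    (lift : ∀ {T : A} (t : ∀ n, T ⟶ E n), ∃ a : T ⟶ S, ∀ n, a ≫ π n = t n)
    (ext : ∀ {T : A} (a b : T ⟶ S), (∀ n, a ≫ π n = b ≫ π n) → a = b)
    (φ : S ⟶ S) (hφ : ∀ n, φ ≫ π n = π n - π (n + 1) ≫ e n) : Epi φ := by
  obtain ⟨Q, p, q, r, hp, hq₀, hq, hr⟩ := exists_iterated_pullback e π
  let F : ℕᵒᵖ ⥤ A := Functor.ofOpSequence p
  let c := limit.cone F
  let l : ∀ n, c.pt ⟶ Q n := fun n ↦ c.π.app (Opposite.op n)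
  have hF : ∀ n, F.map (homOfLE (Nat.le_succ n)).op = p n :=
    fun n ↦ Functor.ofOpSequence_map_homOfLE_succ p n
  have hl : ∀ n, l (n + 1) ≫ p n = l n := fun n ↦ by
    rw [← hF]
    exact c.w _
  have : Epi (l 0) := hA F c (limit.isLimit F) (fun n ↦ by rw [hF]; exact hp n) 0
  have hlq : ∀ n, l n ≫ q n = l 0 ≫ q 0 := fun n ↦ by
    induction n with
    | zero => rfl
    | succ n hn => rw [hq, ← Category.assoc, hl, hn]
  obtain ⟨a, ha⟩ := lift (fun n ↦ l n ≫ r n)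
  have hfac : a ≫ φ = l 0 ≫ q 0 := ext _ _ (fun n ↦ by
    rw [Category.assoc, hφ, Preadditive.comp_sub, ← Category.assoc, ha, ha, Category.assoc, hr,
      ← Category.assoc, hl, Preadditive.comp_sub, sub_sub_cancel, ← Category.assoc, hlq])
  have : Epi (a ≫ φ) := by
    rw [hfac]
    exact epi_comp _ _
  exact epi_of_epi a φ

end SequentialLimits

/-! ### Telescopes of monomorphisms -/

section Mono

/-- In the category `B`, telescope morphisms of sequences of monomorphisms are monomorphisms. -/
def TelescopesOfMonosAreMono (B : Type u') [Category.{v'} B] [Preadditive B] : Prop :=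
  ∀ (E : ℕ → B) (e : ∀ i, E i ⟶ E (i + 1)) (S : B) (ι : ∀ i, E i ⟶ S),
    IsColimit (Cofan.mk S ι) → (∀ i, Mono (e i)) → ∀ φ : S ⟶ S, IsTelescope e ι φ → Mono φ

lemma telescopesOfMonosAreMono_op {A : Type u'} [Category.{v'} A] [Abelian A]
    (hA : SequentialLimitsOfEpis A) [HasLimitsOfShape ℕᵒᵖ A] : TelescopesOfMonosAreMono Aᵒᵖ := by
  intro E e S ι hS he φ hφ
  have he' : ∀ n, Epi (e n).unop := fun n ↦ inferInstance
  have hφ' : ∀ n, φ.unop ≫ (ι n).unop = (ι n).unop - (ι (n + 1)).unop ≫ (e n).unop :=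
    fun n ↦ congrArg Quiver.Hom.unop (hφ n)
  have : Epi φ.unop := epi_of_sequentialLimitsOfEpis hA (fun n ↦ (e n).unop) (fun n ↦ (ι n).unop)
    (fun t ↦ ⟨(coprodDesc hS (fun n ↦ (t n).op)).unop, fun n ↦
      Quiver.Hom.op_inj (ι_coprodDesc hS (fun n ↦ (t n).op) n)⟩)
    (fun a b hab ↦ Quiver.Hom.op_inj (coprod_hom_ext hS (fun n ↦ Quiver.Hom.unop_inj (hab n))))
    φ.unop hφ'
  exact inferInstanceAs (Mono φ.unop.op)

-- A coproduct is the filtered colimit of its finite subcoproducts, and exact filtered colimits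
-- preserve monomorphisms.
open CoproductsFromFiniteFiltered in
lemma mono_of_mono_finite_subcoproducts {A : Type u'} [Category.{v'} A] [Abelian A]
    {J : Type w} [HasColimitsOfShape (Finset (Discrete J)) A]
    [HasExactColimitsOfShape (Finset (Discrete J)) A]
    {E : J → A} {S Z : A} {ι : ∀ i, E i ⟶ S} (hS : IsColimit (Cofan.mk S ι)) (φ : S ⟶ Z)
    (h : ∀ s : Finset (Discrete J),
      Mono (Sigma.desc (fun j : s ↦ ι j.1.as ≫ φ) : (∐ fun j : s ↦ E j.1.as) ⟶ Z)) :
    Mono φ := by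
  classical
  have : HasCoproduct E := ⟨⟨_, hS⟩⟩
  let f : ∐ E ⟶ S := Sigma.desc ι
  let g : S ⟶ ∐ E := coprodDesc hS (Sigma.ι E)
  have hgf : g ≫ f = 𝟙 S := coprod_hom_ext hS (fun j ↦ by
    rw [← Category.assoc, ι_coprodDesc, Sigma.ι_desc, Category.comp_id])
  have hfg : f ≫ g = 𝟙 _ := Sigma.hom_ext _ _ (fun j ↦ by
    rw [← Category.assoc, Sigma.ι_desc]
    simp [g])
  have : IsIso f := ⟨g, hfg, hgf⟩
  let τ : liftToFinsetObj (Discrete.functor E) ⟶ (Functor.const _).obj Z :=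
    { app s := Sigma.desc (fun j : s ↦ ι j.1.as ≫ φ)
      naturality s t a := by
        refine Sigma.hom_ext _ _ (fun j ↦ ?_)
        simp [liftToFinsetObj] }
  have : ∀ s, Mono (τ.app s) := h
  have : Mono τ := NatTrans.mono_of_mono_app τ
  have : Mono (f ≫ φ) := colim.map_mono' τ (isColimitFiniteSubproductsCocone E)
    (isColimitConstCocone _ Z) (f ≫ φ) (fun s ↦ by
      refine Sigma.hom_ext _ _ (fun j ↦ ?_)
      have h₁ : Sigma.ι (fun j : s ↦ E j.1.as) j ≫ Sigma.desc (fun j : s ↦ Sigma.ι E j.1.as) =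
        Sigma.ι E j.1.as := Sigma.ι_desc _ _
      have h₂ : Sigma.ι (fun j : s ↦ E j.1.as) j ≫ Sigma.desc (fun j : s ↦ ι j.1.as ≫ φ) =
        ι j.1.as ≫ φ := Sigma.ι_desc _ _
      refine (Category.assoc _ _ _).symm.trans ((h₁ =≫ (f ≫ φ)).trans ?_)
      refine Eq.trans ?_ (h₂.symm.trans (congrArg _ (Category.comp_id _).symm))
      rw [← Category.assoc, Sigma.ι_desc])
  have h' : φ = g ≫ f ≫ φ := by rw [← Category.assoc, hgf, Category.id_comp]
  have : IsIso g := ⟨f, hgf, hfg⟩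
  rw [h']
  exact mono_comp _ _

/-- On a finite subcoproduct every morphism is finitary, hence detected by its components, and those
of a morphism killed by the telescope vanish. -/
lemma telescopesOfMonosAreMono_of_AB5 (A : Type u') [Category.{v'} A] [Abelian A]
    [HasFilteredColimitsOfSize.{v, v} A] [AB5OfSize.{v, v} A] : TelescopesOfMonosAreMono A := by
  classical
  have : HasFilteredColimitsOfSize.{0, 0} A := hasFilteredColimitsOfSize_of_univLE.{0, 0, v, v}
  have : AB5OfSize.{0, 0} A := AB5OfSize_of_univLE.{0, 0, v, v} A
  intro E e S ι hS _ φ hφ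
  refine mono_of_mono_finite_subcoproducts hS φ (fun s ↦ ?_)
  refine Preadditive.mono_of_cancel_zero _ (fun {T} x hx ↦ ?_)
  let u : (∐ fun j : s ↦ E j.1.as) ⟶ S := Sigma.desc (fun j : s ↦ ι j.1.as)
  have hu : u ≫ φ = Sigma.desc (fun j : s ↦ ι j.1.as ≫ φ) :=
    Sigma.hom_ext _ _ (fun j ↦ by simp [u])
  have hs := coproductIsCoproduct (fun j : s ↦ E j.1.as)
  refine eq_zero_of_mem_finitaryHoms hs (mem_finitaryHoms_of_finite hs x) (fun j ↦ ?_)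
  have hj : coprodProj hs j = u ≫ coprodProj hS j.1.as := Sigma.hom_ext _ _ (fun i ↦ by
    rw [← Category.assoc, Sigma.ι_desc]
    by_cases hij : i = j
    · subst hij
      rw [ι_coprodProj_self hs, ι_coprodProj_self hS]
    · rw [ι_coprodProj_of_ne hs hij, ι_coprodProj_of_ne hS]
      exact fun h ↦ hij (Subtype.ext (Discrete.ext h)))
  rw [hj, ← Category.assoc]
  refine hφ.comp_coprodProj_eq_zero hS ?_ _
  rw [Category.assoc, hu, hx]

end Mono

/-! ### Vanishing of cc and cp functors -/

section HomologicalFunctors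

lemma RespectsCoproducts.isColimit {C : Type u} [Category.{v} C] {B : Type u'}
    [Category.{v'} B] {H : C ⥤ B} (hH : RespectsCoproducts H) {J : Type w}
    [Small.{v} J] {Y : J → C} {S : C} {ι : ∀ j, Y j ⟶ S} (hS : IsColimit (Cofan.mk S ι)) :
    Nonempty (IsColimit (Cofan.mk (H.obj S) (fun j ↦ H.map (ι j)))) := by
  have := hH.preservesColimitsOfShape J
  exact ⟨isColimitCofanMkObjOfIsColimit H Y ι hS⟩

variable {C : Type u} [Category.{v} C] [HasZeroObject C] [HasShift C ℤ] [Preadditive C]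
  [∀ n : ℤ, (shiftFunctor C n).Additive] [Pretriangulated C]
  {B : Type u'} [Category.{v'} B] [Abelian B]

/-- The class of objects annihilated by a functor. -/
def annihilated (H : C ⥤ B) : ObjectProperty C := fun X ↦ IsZero (H.obj X)

lemma annihilated_isStableUnderRetracts {C : Type u} [Category.{v} C] (H : C ⥤ B) :
    (annihilated H).IsStableUnderRetracts where
  of_retract {X Y} r hY := by
    have hY : IsZero (H.obj Y) := hY
    change IsZero (H.obj X)
    rw [IsZero.iff_id_eq_zero, ← H.map_id, ← r.retract, H.map_comp, hY.eq_of_tgt (H.map r.i) 0,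
      Limits.zero_comp]

lemma isZero_of_isColimit_cofan {J : Type w} {E : J → B} {S : B} {ι : ∀ j, E j ⟶ S}
    (hS : IsColimit (Cofan.mk S ι)) (hE : ∀ j, IsZero (E j)) : IsZero S := by
  rw [IsZero.iff_id_eq_zero]
  exact coprod_hom_ext hS (fun j ↦ (hE j).eq_of_src _ _)

lemma annihilated_isSmashingClass {C : Type u} [Category.{v} C] {H : C ⥤ B}
    (hH : RespectsCoproducts H) :
    IsSmashingClass (annihilated H) := by
  rw [isSmashingClass_iff]
  intro J Y S ι hS hY
  obtain ⟨hS'⟩ := hH.isColimit hS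
  exact isZero_of_isColimit_cofan hS' hY

lemma exact_map_distTriang (H : C ⥤ B) [H.IsHomological] {X Y Z : C} {f : X ⟶ Y} {g : Y ⟶ Z}
    {h : Z ⟶ X⟦(1 : ℤ)⟧} (hT : Triangle.mk f g h ∈ distTriang C) :
    (ShortComplex.mk (H.map f) (H.map g)
      (by rw [← H.map_comp, distTriang_comp₁₂ hT, H.map_zero])).Exact :=
  H.map_distinguished_exact _ hT

lemma annihilated_isExtensionClosed (H : C ⥤ B) [H.IsHomological] :
    IsExtensionClosed (annihilated H) where
  containsZero := ⟨_, isZero_zero C, H.map_isZero (isZero_zero C)⟩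
  ext T hT h₁ h₃ := (H.map_distinguished_exact T hT).isZero_of_both_zeros
    (IsZero.eq_of_src h₁ _ _) (IsZero.eq_of_tgt h₃ _ _)

lemma mono_map_shift_of_isCone (H : C ⥤ B) [H.IsHomological] [H.Additive] {X Y Z : C} {f : X ⟶ Y}
    (hf : IsCone f Z) (hZ : IsZero (H.obj Z)) : Mono (H.map (f⟦(1 : ℤ)⟧')) := by
  obtain ⟨g, h, hT⟩ := hf
  have hT' : Triangle.mk h (-f⟦(1 : ℤ)⟧') (-g⟦(1 : ℤ)⟧') ∈ distTriang C :=
    rot_of_distTriang _ (rot_of_distTriang _ hT)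
  have h₁ : Mono (H.map (-f⟦(1 : ℤ)⟧')) := (exact_map_distTriang H hT').mono_g (hZ.eq_of_src _ _)
  rw [H.map_neg] at h₁
  have h₂ : H.map (f⟦(1 : ℤ)⟧') = -(-H.map (f⟦(1 : ℤ)⟧')) := (neg_neg _).symm
  rw [h₂]
  infer_instance

/-- Vanishing of `H` on the cones makes each `H.map ((f n)⟦1⟧')` monic, hence also the image of the
shifted telescope. Thus `H.map h = 0`, and `H.obj X` sits exactly between two zero morphisms. -/
lemma annihilated_stronglyExtensionClosed [HasCoproducts.{v} C] (H : C ⥤ B) [H.IsHomological]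
    [H.Additive] (hH : RespectsCoproducts H) (hB : TelescopesOfMonosAreMono B) :
    IsStronglyExtensionClosed (annihilated H) where
  containsZero := (annihilated_isExtensionClosed H).containsZero
  sequentialExtensions_le := by
    rintro X ⟨Y, f, h₀, hf, g, h, hT⟩
    have hY : ∀ n, IsZero (H.obj (Y n)) :=
      (annihilated_isExtensionClosed H).prop_sequence h₀ hf
    have hS := coproductIsCoproduct Y
    obtain ⟨hS₀⟩ := hH.isColimit hS
    obtain ⟨hS₁⟩ := hH.isColimit (isColimitShift hS 1)
    have hmono : Mono (H.map ((telescopeMap Y f)⟦(1 : ℤ)⟧')) :=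
      hB _ _ _ _ hS₁ (fun n ↦ by
        obtain ⟨Z, hZ, hc⟩ := hf n
        exact mono_map_shift_of_isCone H hc hZ) _
        (((isTelescope_telescopeMap f).map (shiftFunctor C (1 : ℤ))).map H)
    have hh : H.map h = 0 := by
      rw [← cancel_mono (H.map ((telescopeMap Y f)⟦(1 : ℤ)⟧')), ← H.map_comp,
        distTriang_comp₃₁ hT, H.map_zero, Limits.zero_comp]
    exact (exact_map_distTriang H (rot_of_distTriang _ hT)).isZero_of_both_zeros
      ((isZero_of_isColimit_cofan hS₀ hY).eq_of_src _ _) hh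

lemma strongExtensionClosure_le_annihilated [HasCoproducts.{v} C] {P : ObjectProperty C}
    (H : C ⥤ B) [H.IsHomological] [H.Additive] (hH : RespectsCoproducts H)
    (hB : TelescopesOfMonosAreMono B) (hP : P ≤ annihilated H) :
    strongExtensionClosure P ≤ annihilated H :=
  strongExtensionClosure_le (annihilated_stronglyExtensionClosed H hH hB)
    (annihilated_isStableUnderRetracts H) (annihilated_isSmashingClass hH) hP

lemma IsCCFunctor.isZero [HasCoproducts.{v} C] {P : ObjectProperty C}
    [HasFilteredColimitsOfSize.{v, v} B] [AB5OfSize.{v, v} B] {H : C ⥤ B} (hH : IsCCFunctor H)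
    (hP : ∀ X, P X → IsZero (H.obj X)) : ∀ X, strongExtensionClosure P X → IsZero (H.obj X) := by
  have := hH.additive
  have := hH.homological
  exact strongExtensionClosure_le_annihilated H hH.coproducts
    (telescopesOfMonosAreMono_of_AB5.{v} B) hP

/-- A cp functor is treated as a coproduct-preserving homological functor to the opposite category.
-/
lemma IsCPFunctor.isZero [HasCoproducts.{v} C] {P : ObjectProperty C}
    [HasProducts.{v} B] (hB : SequentialLimitsOfEpis B) {H : Cᵒᵖ ⥤ B} (hH : IsCPFunctor H)
    (hP : ∀ X, P X → IsZero (H.obj (Opposite.op X))) :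
    ∀ X, strongExtensionClosure P X → IsZero (H.obj (Opposite.op X)) := by
  have := hH.additive
  have := hH.cohomological
  have : HasProducts.{0} B := hasProducts_shrink.{0, v}
  have : HasLimitsOfSize.{0, 0} B := has_limits_of_hasEqualizers_and_products
  exact fun X hX ↦ (strongExtensionClosure_le_annihilated H.rightOp hH.products.rightOp
    (telescopesOfMonosAreMono_op hB) (fun Y hY ↦ (hP Y hY).op) X hX).unop

end HomologicalFunctors

/-! ### The correspondence with classes of compact objects -/

section Correspondence

variable {C : Type u} [Category.{v} C] [HasZeroObject C] [HasShift C ℤ] [Preadditive C]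
  [∀ n : ℤ, (shiftFunctor C n).Additive] [Pretriangulated C]

/-- The compact part lies between a generating set and the left class, which have the same right
orthogonal. -/
lemma TorsionTheory.isGeneratedBy_compactPart {s : TorsionTheory C}
    (hs : s.IsCompactlyGenerated) : s.IsGeneratedBy s.compactPart := by
  obtain ⟨P, _, hP, hgen⟩ := hs
  have hle : P ≤ s.compactPart := le_inf (fun X hX ↦ by
    rw [← s.leftOrthogonal_right, ← hgen]
    exact fun Y a hY ↦ hY a hX) hP
  refine le_antisymm (fun Y hY ↦ ?_) (fun Y hY X a hX ↦ ?_)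
  · rw [← hgen]
    exact fun X a hX ↦ hY a (hle _ hX)
  · rw [← s.rightOrthogonal_left] at hY
    exact hY a hX.1

variable [HasCoproducts.{v} C]

lemma TorsionTheory.compactPart_eq_envelope {s : TorsionTheory C} {P : ObjectProperty C}
    [ObjectProperty.Small.{v} P] (hP : P ≤ compactObjects C) (hs : s.IsGeneratedBy P) :
    s.compactPart = envelope P := by
  rw [← strongExtensionClosure_inf_compactObjects hP,
    strongExtensionClosure_eq_leftOrthogonal hP, compactPart, ← s.leftOrthogonal_right, hs]

lemma generatedTorsionTheory_isGeneratedBy (P : ObjectProperty C) [ObjectProperty.Small.{v} P]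
    (hP : P ≤ compactObjects C) : (generatedTorsionTheory P hP).IsGeneratedBy P :=
  rfl

variable (C) in
lemma compactPart_bijOn : Set.BijOn (fun s : TorsionTheory C ↦ s.compactPart)
    {s | s.IsCompactlyGenerated}
    {Q | ObjectProperty.EssentiallySmall.{v} Q ∧ Q.IsStableUnderRetracts ∧
      IsExtensionClosed Q ∧ Q ≤ compactObjects C} := by
  refine ⟨?_, ?_, ?_⟩
  · rintro s ⟨P, _, hP, hs⟩
    have h := TorsionTheory.compactPart_eq_envelope hP hs
    change _ ∧ _
    dsimp only
    rw [h]
    exact ⟨essentiallySmall_envelope P, inferInstance, envelope_isExtensionClosed P,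
      envelope_le_compactObjects hP⟩
  · intro s hs s' hs' h
    have hg := TorsionTheory.isGeneratedBy_compactPart hs
    have hg' := TorsionTheory.isGeneratedBy_compactPart hs'
    refine TorsionTheory.ext_of_isGeneratedBy hg' ?_
    rwa [← show s.compactPart = s'.compactPart from h]
  · rintro Q ⟨_, _, hQ, hQc⟩
    -- Now `Q` is the isomorphism closure of a small `P`; being itself an envelope, it equals that
    -- of `P`.
    obtain ⟨P, _, rfl⟩ := ObjectProperty.EssentiallySmall.exists_small.{v} Q
    have hP : P ≤ compactObjects C := P.le_isoClosure.trans hQc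
    refine ⟨generatedTorsionTheory P hP, ⟨P, inferInstance, hP, rfl⟩, ?_⟩
    dsimp only
    rw [TorsionTheory.compactPart_eq_envelope hP (generatedTorsionTheory_isGeneratedBy P hP)]
    refine le_antisymm (envelope_le inferInstance hQ P.le_isoClosure) ?_
    rw [ObjectProperty.isoClosure_le_iff]
    exact le_envelope P

end Correspondence

end TorsionHull

open TorsionHull in
theorem mainTheorem3 {C : Type u} [Category.{v} C] [HasZeroObject C] [HasShift C ℤ]
    [Preadditive C] [∀ n : ℤ, (shiftFunctor C n).Additive] [Pretriangulated C]
    [IsTriangulated C] [HasCoproducts.{v} C] :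
    (∀ P : ObjectProperty C, ObjectProperty.Small.{v} P → P ≤ compactObjects C →
      ∃ s : TorsionTheory C,
        s.left = strongExtensionClosure P ∧
        s.right = P.rightOrthogonal ∧
        s.IsSmashing ∧
        s.IsGeneratedBy P ∧
        (∀ s' : TorsionTheory C, s'.IsGeneratedBy P → s' = s) ∧
        s.left = bigHull P ∧
        (∀ M : C, ∃ L : C, naiveBigHull P L ∧ s.IsLeftPart L M) ∧
        s.compactPart = envelope P ∧
        (∀ t : TStructure C, s.IsAssociatedWith t → s.left = naiveBigHull P) ∧
        (∀ (A : Type u') [Category.{v'} A] [Abelian A] [HasProducts.{v} A] [AB4StarOfSize.{v} A]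
          (H : Cᵒᵖ ⥤ A), SequentialLimitsOfEpis A → IsCPFunctor H → (∀ X, P X → IsZero (H.obj (Opposite.op X))) →
            ∀ X, s.left X → IsZero (H.obj (Opposite.op X))) ∧
        (∀ (A : Type u') [Category.{v'} A] [Abelian A] [HasFilteredColimitsOfSize.{v, v} A]
          [AB5OfSize.{v, v} A]
          (H : C ⥤ A), IsCCFunctor H → (∀ X, P X → IsZero (H.obj X)) →
            ∀ X, s.left X → IsZero (H.obj X))) ∧
    Set.BijOn (fun s : TorsionTheory C ↦ s.compactPart)
      {s | s.IsCompactlyGenerated}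
      {Q | ObjectProperty.EssentiallySmall.{v} Q ∧ Q.IsStableUnderRetracts ∧
        IsExtensionClosed Q ∧ Q ≤ compactObjects C} := by
  refine ⟨fun P _ hP ↦ ?_, compactPart_bijOn C⟩
  have hs := generatedTorsionTheory_isGeneratedBy P hP
  refine ⟨generatedTorsionTheory P hP, rfl, rfl, rightOrthogonal_isSmashingClass hP, hs,
    fun s' hs' ↦ TorsionTheory.ext_of_isGeneratedBy hs hs', ?_, fun M ↦ ?_,
    TorsionTheory.compactPart_eq_envelope hP hs,
    fun t ht ↦ TorsionTheory.left_eq_naiveBigHull_of_isAssociatedWith hP hs ht, ?_, ?_⟩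
  · exact (strongExtensionClosure_eq_leftOrthogonal hP).trans (bigHull_eq_leftOrthogonal hP).symm
  · obtain ⟨L, R, a, n, d, hT, hL, hR⟩ := exists_decomposition hP M
    exact ⟨L, hL, R, a, n, d, hT,
      bigHull_le_strongExtensionClosure P _ (ObjectProperty.le_retractClosure _ _ hL), hR⟩
  · intro A _ _ _ _ H hA hH hHP
    exact hH.isZero hA hHP
  · intro A _ _ _ _ H hH hHP
    exact hH.isZero hHP
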